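/- Let $n \ge 2$ be an integer and let $Q_n$ be the $n$-dimensional hypercube, that is, the graph whose vertices are the $n$-bit strings, two of them being adjacent if and only if they differ in exactly one bit. Let $M$ be a matching in $Q_n$, i.e. a set of pairwise non-adjacent edges (no two distinct edges share a vertex) of $Q_n$, such that $$|M| < \frac{n^2}{12} + \frac{n}{4} + \frac12 .$$ Then there is a cycle $C$ in $Q_n$ of length at least $\frac34 \cdot 2^n$ that contains every edge of $M$. -/

import Mathlib

/-- The `n`-dimensional hypercube: its vertices are the `n`-bit strings, and two of them are
adjacent if and only if they differ in exactly one bit. -/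
def hypercube (n : ℕ) : SimpleGraph (Fin n → Bool) where
  Adj u v := hammingDist u v = 1
  symm := ⟨fun u v h => by rw [hammingDist_comm]; exact h⟩
  loopless := ⟨fun u h => by simp at h⟩

/-!
A matching `M` of the complete graph on the vertices of the cube, whose pairs need not be edges of
the cube, is encoded by an involution `p` of the vertices. Such a matching is *extendable* if some
cycle contains all its pairs as edges and otherwise consists of edges of the cube
(`IsExtendable`). It is shown by induction on the dimension `n ≥ 4` that each such matching with at
most `1 + ⌊(n + 1)² / 8⌋` pairs is extendable to a cycle through at least `3/4 · 2ⁿ` vertices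
(`isExtendable_of_card_le`); a matching of the cube itself is the special case in which the
cycle lies in the cube.

Inductive step. Split the cube into two halves along a direction `d`. If a positive even number of
pairs crosses between the halves, match their ends in the first half among themselves in any way,
together with the pairs inside this half, and take a cycle of the first half through all these
pairs. Deleting the auxiliary pairs leaves disjoint paths. In the second half, match the ends of
two crossing pairs whenever their partners are the two ends of one of these paths, and take a cycle
of the second half through these pairs. Replacing each of them with the path it stands for gives the
required cycle (`splice_isSingleCycle`, `isExtendable_prism_of_even`). If the number of crossing
pairs is odd, an edge in direction `d` with uncovered ends is added to them; if it is zero, the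
cycles of the two halves are joined at a pair of parallel edges. No vertices are lost in the step.

The numbers of pairs that occur in the two halves are about half the numbers of covered vertices
there, so that `d` should split the covered vertices in a balanced way. If `z` is the vertex of
majority coordinates, the sizes of the minorities add up to the sum of the Hamming distances from
`z`, and at most `1 + n` of the covered vertices have distance less than two from `z`
(`two_mul_card_le_sum_min`). The average over all directions makes a quadratic number of pairs
possible (`exists_balanced_direction`, `mul_pairBound_succ_le`).

For the start of the induction, all matchings of the complete graph on the vertices of the cube of
dimension three are searched by the kernel (`isExtendable_three`), and the step just described,
with any direction crossed by some pair, leads to the case of at most four pairs in dimension four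
(`isExtendable_four`). The loss of a quarter of the vertices occurs in dimension three, where a
cycle may miss two of the eight vertices.
-/

namespace HypercubeMatching

open Finset SimpleGraph

/-! ### Graphs consisting of one cycle -/

section Cycles

variable {V : Type*}

/-- `C` is a single cycle (together with isolated vertices): every vertex has no neighbour or
exactly two, and all the vertices that have neighbours lie in one component. -/
structure IsSingleCycle (C : SimpleGraph V) : Prop where
  isCycles : C.IsCycles
  reachable : ∀ u ∈ C.support, ∀ v ∈ C.support, C.Reachable u v

lemma isCycles_of_forall_adj {C : SimpleGraph V}
    (h : ∀ v w, C.Adj v w → ∃ a b, a ≠ b ∧ ∀ x, C.Adj v x ↔ x = a ∨ x = b) : C.IsCycles := by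
  rintro v ⟨w, hw⟩
  obtain ⟨a, b, hab, h'⟩ := h v w hw
  exact Set.ncard_eq_two.2 ⟨a, b, hab, by ext x; simpa using h' x⟩

lemma exists_adj_iff_of_adj {C : SimpleGraph V} (h : C.IsCycles) {v w : V} (hw : C.Adj v w) :
    ∃ b, w ≠ b ∧ ∀ x, C.Adj v x ↔ x = w ∨ x = b := by
  obtain ⟨b, ⟨hb, hvb⟩, hu⟩ := h.existsUnique_ne_adj hw
  refine ⟨b, hb, fun x => ⟨fun hx => ?_, ?_⟩⟩
  · by_cases hxw : x = w
    · exact Or.inl hxw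
    · exact Or.inr (hu x ⟨Ne.symm hxw, hx⟩)
  · rintro (rfl | rfl) <;> assumption

/-- The graph of the closed polygon `g 0, g 1, …, g (N - 1), g 0`. -/
def polygon {N : ℕ} [NeZero N] (g : Fin N → V) (hN : 2 ≤ N) (hg : Function.Injective g) :
    SimpleGraph V where
  Adj u v := ∃ i, (u = g i ∧ v = g (i + 1)) ∨ (v = g i ∧ u = g (i + 1))
  symm := ⟨fun u v ⟨i, h⟩ => ⟨i, h.symm⟩⟩
  loopless := ⟨fun u ⟨i, h⟩ => by
    have h' : i = i + 1 := hg (by rcases h with ⟨h1, h2⟩ | ⟨h1, h2⟩ <;> rw [← h1, ← h2])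
    have h1 : (1 : Fin N) = 0 := left_eq_add.mp h'
    have h2 := congrArg Fin.val h1
    rw [Fin.val_one', Fin.val_zero, Nat.mod_eq_of_lt hN] at h2
    exact one_ne_zero h2⟩

open scoped Fin.NatCast Fin.CommRing in
lemma polygon_isSingleCycle {N : ℕ} [NeZero N] (g : Fin N → V) (hN : 3 ≤ N)
    (hg : Function.Injective g) : IsSingleCycle (polygon g (by omega) hg) := by
  constructor
  · refine isCycles_of_forall_adj fun v w h => ?_
    have key : ∀ i, ∃ a b, a ≠ b ∧ ∀ x, (polygon g (by omega) hg).Adj (g i) x ↔ x = a ∨ x = b := by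
      intro i
      refine ⟨g (i + 1), g (i - 1), fun h => ?_, fun x => ⟨?_, ?_⟩⟩
      · have h1 : (1 : Fin N) + 1 = 0 := by
          have := hg h
          rw [sub_eq_add_neg, add_right_inj] at this
          rw [← sub_eq_zero, sub_neg_eq_add] at this
          exact this
        have h2 := congrArg Fin.val h1
        rw [Fin.val_add, Fin.val_one', Fin.val_zero, Nat.mod_eq_of_lt (by omega : 1 < N),
          Nat.mod_eq_of_lt (by omega)] at h2
        omega
      · rintro ⟨j, ⟨h1, h2⟩ | ⟨h1, h2⟩⟩
        · left; rw [h2, hg h1]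
        · right; rw [h1, hg h2, add_sub_cancel_right]
      · rintro (rfl | rfl)
        · exact ⟨i, Or.inl ⟨rfl, rfl⟩⟩
        · exact ⟨i - 1, Or.inr ⟨rfl, by rw [sub_add_cancel]⟩⟩
    obtain ⟨i, ⟨rfl, -⟩ | ⟨-, rfl⟩⟩ := h
    · exact key i
    · exact key (i + 1)
  · have h0 : ∀ n : ℕ, (polygon g (by omega) hg).Reachable (g 0) (g n) := by
      intro n
      induction n with
      | zero => simp
      | succ n ih =>
        refine ih.trans (Adj.reachable ⟨n, Or.inl ⟨rfl, ?_⟩⟩)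
        rw [Nat.cast_succ]
    have h1 : ∀ u ∈ (polygon g (by omega) hg).support,
        (polygon g (by omega) hg).Reachable (g 0) u := by
      rintro u ⟨w, i, ⟨rfl, -⟩ | ⟨-, rfl⟩⟩
      · simpa using h0 i.val
      · simpa using h0 (i + 1 : Fin N).val
    exact fun u hu v hv => (h1 u hu).symm.trans (h1 v hv)

lemma polygon_support {N : ℕ} [NeZero N] (g : Fin N → V) (hN : 3 ≤ N)
    (hg : Function.Injective g) : (polygon g (by omega) hg).support = Set.range g := by
  ext u
  constructor
  · rintro ⟨w, i, ⟨rfl, -⟩ | ⟨-, rfl⟩⟩ <;> exact ⟨_, rfl⟩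
  · rintro ⟨i, rfl⟩
    exact ⟨g (i + 1), i, Or.inl ⟨rfl, rfl⟩⟩

/-- A graph that is a single cycle is traversed by a closed walk. -/
lemma IsSingleCycle.exists_walk [Finite V] {C : SimpleGraph V} (hC : IsSingleCycle C)
    (hne : C.support.Nonempty) :
    ∃ (u : V) (w : C.Walk u u), w.IsCycle ∧ (∀ e ∈ C.edgeSet, e ∈ w.edges) ∧
      w.length = C.support.ncard := by
  classical
  have := Fintype.ofFinite V
  obtain ⟨u, hu⟩ := hne
  obtain ⟨w, hw, hv⟩ := hC.isCycles.exists_cycle_toSubgraph_verts_eq_connectedComponentSupp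
    (c := C.connectedComponentMk u) (v := u) rfl hu
  have hsupp : w.toSubgraph.verts = C.support := by
    rw [hv]
    ext v
    rw [ConnectedComponent.mem_supp_iff, ConnectedComponent.eq]
    constructor
    · intro h
      by_cases huv : v = u
      · rwa [huv]
      · exact mem_support_of_reachable huv h
    · exact fun h => hC.reachable v h u hu
  refine ⟨u, w, hw, ?_, ?_⟩
  · intro e
    induction e with | _ a b
    intro hab
    rw [← Walk.mem_edges_toSubgraph, Subgraph.mem_edgeSet]
    exact (hw.adj_toSubgraph_iff_of_isCycles hC.isCycles (by rw [hsupp]; exact ⟨b, hab⟩) b).2 hab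
  · rw [← hsupp]
    have h1 : w.toSubgraph.verts = (w.support.tail.toFinset : Set V) := by
      ext x
      simp only [Walk.mem_verts_toSubgraph, List.coe_toFinset, Set.mem_ofPred_eq]
      rw [Walk.mem_support_iff]
      constructor
      · rintro (rfl | h)
        · exact Walk.end_mem_tail_support (hw.not_nil)
        · exact h
      · exact Or.inr
    rw [h1, Set.ncard_coe_finset, List.toFinset_card_of_nodup hw.support_nodup]
    simp

end Cycles

/-! ### Cutting a cycle at the edges of a matching -/

section Pairing

variable {V : Type*}

/-- The graph `C` without the edges `{x, f x}`. -/
def cut (C : SimpleGraph V) (f : V → V) : SimpleGraph V where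
  Adj x y := C.Adj x y ∧ f x ≠ y ∧ f y ≠ x
  symm := ⟨fun _ _ h => ⟨h.1.symm, h.2.2, h.2.1⟩⟩
  loopless := ⟨fun _ h => h.1.ne rfl⟩

lemma cut_adj {C : SimpleGraph V} {f : V → V} (hf : Function.Involutive f) {x y : V} :
    (cut C f).Adj x y ↔ C.Adj x y ∧ f x ≠ y :=
  ⟨fun h => ⟨h.1, h.2.1⟩, fun h => ⟨h.1, h.2, fun h' => h.2 (by rw [← h', hf y])⟩⟩

lemma cut_neighborSet {C : SimpleGraph V} (hC : C.IsCycles) {f : V → V}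
    (hf : Function.Involutive f) (hfC : ∀ x, f x ≠ x → C.Adj x (f x)) {x : V} (hx : f x ≠ x) :
    ∃ b, f x ≠ b ∧ C.Adj x b ∧ ∀ y, (cut C f).Adj x y ↔ y = b := by
  obtain ⟨b, hb, h⟩ := exists_adj_iff_of_adj hC (hfC x hx)
  refine ⟨b, hb, (h b).2 (Or.inr rfl), fun y => ?_⟩
  rw [cut_adj hf, h y]
  constructor
  · rintro ⟨h1 | h1, h2⟩
    · exact absurd h1.symm h2
    · exact h1
  · rintro rfl
    exact ⟨Or.inr rfl, hb⟩

/-- Each component of a cut cycle is a path, so that it contains either none or exactly two of the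
vertices at which the cycle was cut. -/
lemma existsUnique_cut_reachable [Finite V] {C : SimpleGraph V} (hC : C.IsCycles) {f : V → V}
    (hf : Function.Involutive f) (hfC : ∀ x, f x ≠ x → C.Adj x (f x)) {x : V} (hx : f x ≠ x) :
    ∃! y, y ≠ x ∧ f y ≠ y ∧ (cut C f).Reachable x y := by
  classical
  have := Fintype.ofFinite V
  set H := cut C f with hH
  set K := H.connectedComponentMk x with hK
  have hKmem : ∀ v : V, v ∈ K ↔ H.Reachable x v := by
    intro v
    change H.connectedComponentMk v = H.connectedComponentMk x ↔ _
    rw [ConnectedComponent.eq]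
    exact ⟨Reachable.symm, Reachable.symm⟩
  have hxK : x ∈ K := (hKmem x).2 (Reachable.refl x)
  have hdegH : ∀ v ∈ K, H.degree v + (if f v ≠ v then 1 else 0) = 2 := by
    intro v hv
    by_cases hfv : f v = v
    · rw [if_neg (not_not.2 hfv), add_zero]
      have hvx : v ≠ x := fun h => hx (h ▸ hfv)
      obtain ⟨w, hw⟩ := mem_support_of_reachable hvx ((hKmem v).1 hv).symm
      obtain ⟨b, hb, h⟩ := exists_adj_iff_of_adj hC hw.1
      rw [← card_neighborFinset_eq_degree, Finset.card_eq_two]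
      refine ⟨w, b, hb, ?_⟩
      ext y
      rw [mem_neighborFinset, hH, cut_adj hf, hfv, h y, Finset.mem_insert, Finset.mem_singleton]
      refine ⟨And.left, fun hy => ⟨hy, ?_⟩⟩
      exact ((h y).2 hy).ne
    · rw [if_pos hfv]
      obtain ⟨b, -, -, h⟩ := cut_neighborSet hC hf hfC hfv
      rw [← card_neighborFinset_eq_degree]
      have : H.neighborFinset v = {b} := by
        ext y
        rw [mem_neighborFinset, h y, Finset.mem_singleton]
      rw [this, Finset.card_singleton]
  set D := K.toSimpleGraph with hD
  have hdegD : ∀ v : K, D.degree v + (if f v ≠ v then 1 else 0) = 2 := by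
    intro v
    rw [← hdegH v v.2]
    congr 1
    have : (H.neighborSet v) ⊆ K.supp := by
      intro w hw
      exact (hKmem w).2 (((hKmem v).1 v.2).trans (Adj.reachable hw))
    have h2 := degree_induce_of_neighborSet_subset (G := H) (s := K.supp) (v := v) this
    rw [← h2, ← card_neighborSet_eq_degree, ← card_neighborSet_eq_degree]
    exact Fintype.card_congr (Equiv.refl _)
  set T : Finset K := Finset.univ.filter fun v => f v ≠ v with hT
  have hsum : 2 * #D.edgeFinset + #T = 2 * Fintype.card K := by
    rw [← sum_degrees_eq_twice_card_edges, hT, Finset.card_filter, ← Finset.sum_add_distrib,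
      Finset.sum_congr rfl (fun v _ => hdegD v)]
    simp [mul_comm]
  have hedge : Fintype.card K ≤ #D.edgeFinset + 1 := by
    have := (K.connected_toSimpleGraph).card_vert_le_card_edgeSet_add_one
    rwa [Nat.card_eq_fintype_card, Nat.card_eq_fintype_card, ← edgeFinset_card] at this
  have hxT : (⟨x, hxK⟩ : K) ∈ T := by simp [hT, hx]
  have hpos : 0 < #T := Finset.card_pos.2 ⟨_, hxT⟩
  have hT2 : #T = 2 := by omega
  obtain ⟨y, hy⟩ : ∃ y, T = {⟨x, hxK⟩, y} ∧ y ≠ ⟨x, hxK⟩ := by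
    obtain ⟨a, b, hab, h⟩ := Finset.card_eq_two.1 hT2
    rw [h, Finset.mem_insert, Finset.mem_singleton] at hxT
    rcases hxT with rfl | rfl
    · exact ⟨b, h, hab.symm⟩
    · exact ⟨a, by rw [h, Finset.pair_comm], hab⟩
  have hyT : y ∈ T := by rw [hy.1]; simp
  refine ⟨y, ⟨fun h => hy.2 (Subtype.ext h), (Finset.mem_filter.1 hyT).2, (hKmem y).1 y.2⟩, ?_⟩
  rintro z ⟨hzx, hfz, hz⟩
  have hzT : (⟨z, (hKmem z).2 hz⟩ : K) ∈ T := by simp [hT, hfz]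
  rw [hy.1, Finset.mem_insert, Finset.mem_singleton] at hzT
  rcases hzT with h | h
  · exact absurd (congrArg Subtype.val h) hzx
  · exact congrArg Subtype.val h

/-- The pairs of ends of the paths into which a cut cycle falls. -/
lemma exists_endpoint_pairing [Finite V] {C : SimpleGraph V} (hC : C.IsCycles) {f : V → V}
    (hf : Function.Involutive f) (hfC : ∀ x, f x ≠ x → C.Adj x (f x)) :
    ∃ L : V → V, Function.Involutive L ∧ (∀ x, L x ≠ x ↔ f x ≠ x) ∧
      ∀ x, (cut C f).Reachable x (L x) := by
  classical
  choose! L hL hu using fun x (hx : f x ≠ x) => existsUnique_cut_reachable hC hf hfC hx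
  refine ⟨fun x => if f x ≠ x then L x else x, fun x => ?_, fun x => ?_, fun x => ?_⟩
  · by_cases hx : f x ≠ x
    · obtain ⟨h1, h2, h3⟩ := hL x hx
      simp only [if_pos hx, if_pos h2]
      exact (hu (L x) h2 x ⟨h1.symm, hx, h3.symm⟩).symm
    · simp only [if_neg hx]
  · by_cases hx : f x ≠ x
    · simp only [if_pos hx]
      exact ⟨fun _ => hx, fun _ => (hL x hx).1⟩
    · simp [hx]
  · by_cases hx : f x ≠ x
    · simp only [if_pos hx]
      exact (hL x hx).2.2
    · simp only [if_neg hx]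
      exact Reachable.refl x

lemma exists_cut_reachable {C : SimpleGraph V} (hC : IsSingleCycle C) {f : V → V}
    (hf : Function.Involutive f) (hfC : ∀ x, f x ≠ x → C.Adj x (f x)) {a : V} (ha : f a ≠ a)
    {v : V} (hv : v ∈ C.support) : ∃ b, f b ≠ b ∧ (cut C f).Reachable v b := by
  obtain ⟨w⟩ := hC.reachable v hv a ⟨_, hfC a ha⟩
  clear hv
  induction w with
  | nil => exact ⟨_, ha, Reachable.refl _⟩
  | @cons u w _ huw _ ih =>
    by_cases h : f u = w
    · exact ⟨u, by rw [h]; exact huw.ne', Reachable.refl _⟩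
    · obtain ⟨b, hb, hr⟩ := ih ha
      exact ⟨b, hb, (Adj.reachable ((cut_adj hf).2 ⟨huw, h⟩)).trans hr⟩

end Pairing

/-! ### Joining two cycles -/

section Splice

variable {W : Type*}

/-- Two graphs `C₀` and `C₁` on `W`, with the edges `{x, f x}` of the first and `{y, q y}` of the
second deleted, put side by side on `Bool × W` and joined by the edges from `(false, a)` to
`(true, c a)`, where `a` runs over the vertices with `f a ≠ a`. -/
def splice (C₀ C₁ : SimpleGraph W) (f q c : W → W) : SimpleGraph (Bool × W) where
  Adj u v := match u, v with
    | (false, x), (false, y) => (cut C₀ f).Adj x y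
    | (true, x), (true, y) => (cut C₁ q).Adj x y
    | (false, x), (true, y) => f x ≠ x ∧ y = c x
    | (true, y), (false, x) => f x ≠ x ∧ y = c x
  symm := ⟨by
    rintro ⟨_ | _, x⟩ ⟨_ | _, y⟩ h
    · exact Adj.symm h
    · exact h
    · exact h
    · exact Adj.symm h⟩
  loopless := ⟨by
    rintro ⟨_ | _, x⟩ h
    · exact (cut C₀ f).loopless.irrefl x h
    · exact (cut C₁ q).loopless.irrefl x h⟩

/-- If `C₀` falls into paths with the pairs of ends `a`, `L a` when it is cut, and `C₁` passes
through the edges `{c a, c (L a)}`, then each of these edges may be replaced with the path from `a`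
to `L a`, and the result is again a single cycle. -/
lemma splice_isSingleCycle {C₀ C₁ : SimpleGraph W} (h₀ : IsSingleCycle C₀)
    (h₁ : IsSingleCycle C₁) {f q c L : W → W} (hf : Function.Involutive f)
    (hq : Function.Involutive q) (hfC : ∀ x, f x ≠ x → C₀.Adj x (f x))
    (hqC : ∀ y, q y ≠ y → C₁.Adj y (q y)) (hL : ∀ x, L x ≠ x ↔ f x ≠ x)
    (hLf : ∀ x, f x ≠ x → f (L x) ≠ L x)
    (hLr : ∀ x, (cut C₀ f).Reachable x (L x))
    (hc : ∀ x y, f x ≠ x → f y ≠ y → c x = c y → x = y)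
    (hqc : ∀ x, f x ≠ x → q (c x) = c (L x))
    (hcq : ∀ y, q y ≠ y → ∃ x, f x ≠ x ∧ y = c x) (hne : ∃ x, f x ≠ x) :
    IsSingleCycle (splice C₀ C₁ f q c) := by
  set R := splice C₀ C₁ f q c with hR
  have r00 : ∀ x y, R.Adj (false, x) (false, y) ↔ (cut C₀ f).Adj x y := fun _ _ => Iff.rfl
  have r11 : ∀ x y, R.Adj (true, x) (true, y) ↔ (cut C₁ q).Adj x y := fun _ _ => Iff.rfl
  have r01 : ∀ x y, R.Adj (false, x) (true, y) ↔ (f x ≠ x ∧ y = c x) := fun _ _ => Iff.rfl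
  have r10 : ∀ x y, R.Adj (true, y) (false, x) ↔ (f x ≠ x ∧ y = c x) := fun _ _ => Iff.rfl
  have hqcne : ∀ x, f x ≠ x → q (c x) ≠ c x := by
    intro x hx h
    rw [hqc x hx] at h
    exact (hL x).2 hx (hc _ _ (hLf x hx) hx h)
  constructor
  · have left : ∀ x z, f x ≠ x → R.Adj (false, x) z →
        ∃ a b, a ≠ b ∧ ∀ y, R.Adj (false, x) y ↔ y = a ∨ y = b := by
      intro x z hx _
      obtain ⟨b, -, -, h⟩ := cut_neighborSet h₀.isCycles hf hfC hx
      refine ⟨(false, b), (true, c x), by simp, ?_⟩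
      rintro ⟨_ | _, y⟩
      · rw [r00, h y]; simp
      · rw [r01]; simp [hx]
    have left' : ∀ x z, f x = x → R.Adj (false, x) z →
        ∃ a b, a ≠ b ∧ ∀ y, R.Adj (false, x) y ↔ y = a ∨ y = b := by
      rintro x ⟨_ | _, z⟩ hx hz
      · obtain ⟨b, hb, h⟩ := exists_adj_iff_of_adj h₀.isCycles ((r00 _ _).1 hz).1
        refine ⟨(false, z), (false, b), by simpa using hb, ?_⟩
        rintro ⟨_ | _, y⟩
        · rw [r00, cut_adj hf, h y, hx]
          simp only [Prod.mk.injEq, true_and, and_iff_left_iff_imp]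
          exact fun hy => ((h y).2 hy).ne
        · rw [r01]; simp [hx]
      · exact absurd hx ((r01 _ _).1 hz).1
    have right : ∀ x z, q x ≠ x → R.Adj (true, x) z →
        ∃ a b, a ≠ b ∧ ∀ y, R.Adj (true, x) y ↔ y = a ∨ y = b := by
      intro x z hx _
      obtain ⟨b, -, -, h⟩ := cut_neighborSet h₁.isCycles hq hqC hx
      obtain ⟨a, ha, hxa⟩ := hcq x hx
      refine ⟨(true, b), (false, a), by simp, ?_⟩
      rintro ⟨_ | _, y⟩
      · rw [r10]
        simp only [Prod.mk.injEq, Bool.false_eq_true, false_and, true_and, false_or]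
        exact ⟨fun hy => hc _ _ hy.1 ha (hy.2.symm.trans hxa), fun hy => hy ▸ ⟨ha, hxa⟩⟩
      · rw [r11, h y]; simp
    have right' : ∀ x z, q x = x → R.Adj (true, x) z →
        ∃ a b, a ≠ b ∧ ∀ y, R.Adj (true, x) y ↔ y = a ∨ y = b := by
      rintro x ⟨_ | _, z⟩ hx hz
      · obtain ⟨h1, h2⟩ := (r10 _ _).1 hz
        exact absurd (h2 ▸ hx) (hqcne z h1)
      · obtain ⟨b, hb, h⟩ := exists_adj_iff_of_adj h₁.isCycles ((r11 _ _).1 hz).1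
        refine ⟨(true, z), (true, b), by simpa using hb, ?_⟩
        rintro ⟨_ | _, y⟩
        · rw [r10]
          simp only [Prod.mk.injEq, Bool.false_eq_true, false_and, or_self, iff_false, not_and]
          intro h1 h2
          exact hqcne y h1 (h2 ▸ hx)
        · rw [r11, cut_adj hq, h y, hx]
          simp only [Prod.mk.injEq, true_and, and_iff_left_iff_imp]
          exact fun hy => ((h y).2 hy).ne
    apply isCycles_of_forall_adj
    rintro ⟨_ | _, x⟩ z hz
    · by_cases hx : f x = x
      · exact left' x z hx hz
      · exact left x z hx hz
    · by_cases hx : q x = x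
      · exact right' x z hx hz
      · exact right x z hx hz
  · have m0 : ∀ x y, (cut C₀ f).Reachable x y → R.Reachable (false, x) (false, y) := by
      rintro x y ⟨w⟩
      induction w with
      | nil => exact Reachable.refl _
      | cons h _ ih => exact (Adj.reachable ((r00 _ _).2 h)).trans ih
    have m1 : ∀ x y, C₁.Reachable x y → R.Reachable (true, x) (true, y) := by
      rintro x y ⟨w⟩
      induction w with
      | nil => exact Reachable.refl _
      | @cons u v _ h _ ih =>
        refine Reachable.trans ?_ ih
        by_cases huv : q u = v
        · obtain ⟨a, ha, rfl⟩ := hcq u (huv ▸ h.ne')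
          rw [hqc a ha] at huv
          subst huv
          exact ((Adj.reachable ((r10 _ _).2 ⟨ha, rfl⟩)).trans (m0 _ _ (hLr a))).trans
            (Adj.reachable ((r01 _ _).2 ⟨hLf a ha, rfl⟩))
        · exact Adj.reachable ((r11 _ _).2 ((cut_adj hq).2 ⟨h, huv⟩))
    -- every vertex of the new graph is joined to a vertex of `C₁`
    have key : ∀ u ∈ R.support, ∃ y ∈ C₁.support, R.Reachable u (true, y) := by
      have hA : ∀ x, f x ≠ x → c x ∈ C₁.support := fun x hx => ⟨_, hqC _ (hqcne x hx)⟩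
      obtain ⟨a, ha⟩ := hne
      rintro ⟨_ | _, x⟩ ⟨⟨_ | _, z⟩, hz⟩
      · obtain ⟨b, hb, hr⟩ := exists_cut_reachable h₀ hf hfC ha ⟨z, ((r00 _ _).1 hz).1⟩
        exact ⟨c b, hA b hb, (m0 _ _ hr).trans (Adj.reachable ((r01 _ _).2 ⟨hb, rfl⟩))⟩
      · obtain ⟨h1, rfl⟩ := (r01 _ _).1 hz
        exact ⟨c x, hA x h1, Adj.reachable hz⟩
      · obtain ⟨h1, rfl⟩ := (r10 _ _).1 hz
        exact ⟨c z, hA z h1, Reachable.refl _⟩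
      · exact ⟨x, ⟨z, ((r11 _ _).1 hz).1⟩, Reachable.refl _⟩
    intro u hu v hv
    obtain ⟨x, hx, hux⟩ := key u hu
    obtain ⟨y, hy, hvy⟩ := key v hv
    exact (hux.trans (m1 _ _ (h₁.reachable x hx y hy))).trans hvy.symm

lemma add_ncard_support_le_splice [Finite W] {C₀ C₁ : SimpleGraph W} (h₀ : C₀.IsCycles)
    (h₁ : C₁.IsCycles) {f q c : W → W} (hf : Function.Involutive f)
    (hq : Function.Involutive q) :
    C₀.support.ncard + C₁.support.ncard ≤ (splice C₀ C₁ f q c).support.ncard := by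
  have cut_support : ∀ (C : SimpleGraph W) (g : W → W), C.IsCycles → Function.Involutive g →
      C.support ⊆ (cut C g).support := by
    rintro C g hC hg x ⟨y, hy⟩
    obtain ⟨b, hb, h⟩ := exists_adj_iff_of_adj hC hy
    by_cases hgy : g x = y
    · exact ⟨b, (cut_adj hg).2 ⟨(h b).2 (Or.inr rfl), by rwa [hgy]⟩⟩
    · exact ⟨y, (cut_adj hg).2 ⟨hy, hgy⟩⟩
  rw [← Set.ncard_image_of_injective C₀.support (Prod.mk_right_injective false),
    ← Set.ncard_image_of_injective C₁.support (Prod.mk_right_injective true),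
    ← Set.ncard_union_eq _ (Set.toFinite _) (Set.toFinite _)]
  · refine Set.ncard_le_ncard ?_ (Set.toFinite _)
    rintro _ (⟨x, hx, rfl⟩ | ⟨x, hx, rfl⟩)
    · obtain ⟨y, hy⟩ := cut_support C₀ f h₀ hf hx
      exact ⟨(false, y), hy⟩
    · obtain ⟨y, hy⟩ := cut_support C₁ q h₁ hq hx
      exact ⟨(true, y), hy⟩
  · rw [Set.disjoint_left]
    rintro _ ⟨x, -, rfl⟩ ⟨y, -, h⟩
    simp at h

end Splice

/-! ### Extending a matching of the complete graph on a prism -/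

section Extendable

variable {V : Type*}

/-- An involution `p` stands for the matching of the complete graph on `V` formed by the pairs
`{v, p v}` with `p v ≠ v`. It is *extendable* in `G` to length `ℓ` if some cycle through at least
`ℓ` vertices contains all these pairs as edges, and all its other edges are edges of `G`. -/
def IsExtendable (G : SimpleGraph V) (p : V → V) (ℓ : ℕ) : Prop :=
  ∃ C : SimpleGraph V, IsSingleCycle C ∧ (∀ v, p v ≠ v → C.Adj v (p v)) ∧
    (∀ u v, C.Adj u v → p u = v ∨ G.Adj u v) ∧ ℓ ≤ C.support.ncard

lemma IsExtendable.mono {G : SimpleGraph V} {p : V → V} {ℓ ℓ' : ℕ} (h : IsExtendable G p ℓ)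
    (hl : ℓ' ≤ ℓ) : IsExtendable G p ℓ' := by
  obtain ⟨C, h1, h2, h3, h4⟩ := h
  exact ⟨C, h1, h2, h3, hl.trans h4⟩

/-- Pairs that are edges of `G` may be dropped from the matching. -/
lemma IsExtendable.of_extension {G : SimpleGraph V} {p p' : V → V} {ℓ : ℕ}
    (h : IsExtendable G p' ℓ) (h1 : ∀ v, p v ≠ v → p' v = p v)
    (h2 : ∀ v, p v = v → p' v = v ∨ G.Adj v (p' v)) : IsExtendable G p ℓ := by
  obtain ⟨C, hC, hp, hG, hl⟩ := h
  refine ⟨C, hC, fun v hv => ?_, fun u v huv => ?_, hl⟩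
  · rw [← h1 v hv]
    exact hp v (by rwa [h1 v hv])
  · rcases hG u v huv with h | h
    · by_cases hu : p u = u
      · rcases h2 u hu with h' | h'
        · exact absurd (h'.symm.trans h) huv.ne
        · exact Or.inr (h ▸ h')
      · exact Or.inl ((h1 u hu).symm.trans h)
    · exact Or.inr h

lemma ncard_support_comap {V' : Type*} (e : V ≃ V') (C : SimpleGraph V') :
    (C.comap e).support.ncard = C.support.ncard := by
  rw [← Set.ncard_image_of_injective _ e.injective]
  congr 1
  ext v
  constructor
  · rintro ⟨u, ⟨w, hw⟩, rfl⟩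
    exact ⟨e w, hw⟩
  · rintro ⟨w, hw⟩
    exact ⟨e.symm v, ⟨e.symm w, by simpa using hw⟩, by simp⟩

lemma IsSingleCycle.comap {V' : Type*} (e : V ≃ V') {C : SimpleGraph V'} (hC : IsSingleCycle C) :
    IsSingleCycle (C.comap e) := by
  constructor
  · refine isCycles_of_forall_adj fun v w h => ?_
    obtain ⟨b, hb, h'⟩ := exists_adj_iff_of_adj hC.isCycles (v := e v) (w := e w) h
    refine ⟨w, e.symm b, fun h => hb (by simp [h]), fun x => ?_⟩
    rw [comap_adj, h' (e x), e.apply_eq_iff_eq, e.eq_symm_apply]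
  · rintro u ⟨u', hu⟩ v ⟨v', hv⟩
    have h1 := hC.reachable (e u) ⟨_, hu⟩ (e v) ⟨_, hv⟩
    have h2 : ∀ a b, C.Reachable a b → (C.comap e).Reachable (e.symm a) (e.symm b) := by
      rintro a b ⟨w⟩
      induction w with
      | nil => exact Reachable.refl _
      | cons h _ ih => exact (Adj.reachable (by simpa using h)).trans ih
    simpa using h2 _ _ h1

lemma IsExtendable.of_equiv {V' : Type*} {G : SimpleGraph V} {G' : SimpleGraph V'} {p : V → V}
    {ℓ : ℕ} (e : V ≃ V') (hG : ∀ u v, G'.Adj (e u) (e v) → G.Adj u v)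
    (h : IsExtendable G' (fun v => e (p (e.symm v))) ℓ) : IsExtendable G p ℓ := by
  obtain ⟨C, hC, hp, hG', hl⟩ := h
  refine ⟨C.comap e, hC.comap e, fun v hv => ?_, fun u v huv => ?_, ?_⟩
  · simpa using hp (e v) (by simpa using hv)
  · rcases hG' _ _ huv with h | h
    · left; simpa using h
    · exact Or.inr (hG _ _ h)
  · rwa [ncard_support_comap]

end Extendable

section Prism

variable {W : Type*}

/-- The prism over `G`: two copies of `G`, with an edge between the two copies of each vertex. -/
def prism (G : SimpleGraph W) : SimpleGraph (Bool × W) where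
  Adj u v := (u.1 = v.1 ∧ G.Adj u.2 v.2) ∨ (u.1 ≠ v.1 ∧ u.2 = v.2)
  symm := ⟨by
    rintro u v (⟨h1, h2⟩ | ⟨h1, h2⟩)
    · exact Or.inl ⟨h1.symm, h2.symm⟩
    · exact Or.inr ⟨h1.symm, h2.symm⟩⟩
  loopless := ⟨by
    rintro u (⟨h1, h2⟩ | ⟨h1, h2⟩)
    · exact h2.ne rfl
    · exact h1 rfl⟩

lemma exists_involutive_of_even [DecidableEq W] {A : Finset W} (hA : Even #A) :
    ∃ f : W → W, Function.Involutive f ∧ ∀ x, f x ≠ x ↔ x ∈ A := by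
  obtain ⟨n, hn⟩ := hA
  induction n generalizing A with
  | zero =>
    rw [Finset.card_eq_zero.1 hn]
    exact ⟨id, fun _ => rfl, by simp⟩
  | succ n ih =>
    obtain ⟨a, ha, b, hb, hab⟩ := Finset.one_lt_card.1 (by omega : 1 < #A)
    have hb' : b ∈ A.erase a := Finset.mem_erase.2 ⟨hab.symm, hb⟩
    obtain ⟨f, hf, hfA⟩ := ih (A := (A.erase a).erase b) (by
      rw [Finset.card_erase_of_mem hb', Finset.card_erase_of_mem ha]; omega)
    have fa : f a = a := by by_contra h; simpa using (hfA a).1 h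
    have fb : f b = b := by by_contra h; simpa using (hfA b).1 h
    refine ⟨fun x => if x = a then b else if x = b then a else f x, fun x => ?_, fun x => ?_⟩
    · by_cases hxa : x = a
      · simp [hxa, hab.symm]
      · by_cases hxb : x = b
        · simp [hxb, hab.symm]
        · have h1 : f x ≠ a := fun h => hxa (by rw [← hf x, h, fa])
          have h2 : f x ≠ b := fun h => hxb (by rw [← hf x, h, fb])
          simp [hxa, hxb, h1, h2, hf x]
    · by_cases hxa : x = a
      · simp [hxa, hab.symm, ha]
      · by_cases hxb : x = b
        · simp [hxb, hab.symm, hab, hb]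
        · have := hfA x
          simp only [Finset.mem_erase, ne_eq, hxa, hxb, not_false_eq_true, true_and] at this
          simpa [hxa, hxb] using this

variable [Fintype W] [DecidableEq W]

/-- The vertices covered by the matching `p`. -/
def moved (p : W → W) : Finset W := univ.filter fun v => p v ≠ v

/-- The vertices covered by the matching `p` in the copy `b` of the base of a prism. -/
def sideMoved (p : Bool × W → Bool × W) (b : Bool) : Finset W :=
  univ.filter fun x => p (b, x) ≠ (b, x)

/-- The vertices in the copy `b` of the base that `p` matches with vertices of the other copy. -/
def crossing (p : Bool × W → Bool × W) (b : Bool) : Finset W :=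
  univ.filter fun x => (p (b, x)).1 ≠ b

/-- If an even, nonzero number of pairs of the matching `p` runs between the two copies of the
base, an extension of `p` is glued from extensions in the two copies. In the first copy, the ends of
the crossing pairs are matched with each other in an arbitrary way; cutting the resulting cycle
there leaves paths, and in the second copy two ends of crossing pairs are matched if their partners
are the ends of one of these paths. -/
theorem isExtendable_prism_of_even {G : SimpleGraph W} {p : Bool × W → Bool × W}
    (hp : Function.Involutive p) {K ℓ : ℕ}
    (ih : ∀ q : W → W, Function.Involutive q → #(moved q) ≤ K → IsExtendable G q ℓ)
    (hK : ∀ b, #(sideMoved p b) ≤ K) (hne : (crossing p false).Nonempty)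
    (heven : Even #(crossing p false)) : IsExtendable (prism G) p (2 * ℓ) := by
  set A := crossing p false with hA
  have memA : ∀ x, x ∈ A ↔ (p (false, x)).1 = true := by simp [hA, crossing]
  obtain ⟨f, hf, hfA⟩ := exists_involutive_of_even heven
  set c : W → W := fun x => (p (false, x)).2 with hc
  have pA : ∀ x ∈ A, p (false, x) = (true, c x) := fun x hx => Prod.ext ((memA x).1 hx) rfl
  have pA' : ∀ x ∉ A, p (false, x) = (false, c x) := fun x hx =>
    Prod.ext (by rw [memA] at hx; simpa using hx) rfl
  have pcA : ∀ x ∈ A, p (true, c x) = (false, x) := fun x hx => by rw [← pA x hx, hp]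
  have pcA' : ∀ x ∉ A, p (false, c x) = (false, x) := fun x hx => by rw [← pA' x hx, hp]
  have hcA' : ∀ x ∉ A, c x ∉ A := by
    intro x hx h
    have := (pA _ h).symm.trans (pcA' x hx)
    simp at this
  have hcinj : ∀ x ∈ A, ∀ y ∈ A, c x = c y → x = y := by
    intro x hx y hy h
    have := pcA x hx
    rw [h, pcA y hy] at this
    simpa using this.symm
  set p₀ : W → W := fun x => if x ∈ A then f x else c x with hp₀
  have p₀inv : Function.Involutive p₀ := by
    intro x
    by_cases hx : x ∈ A
    · have : f x ∈ A := by
        rw [← hfA] at hx ⊢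
        rw [hf x]; exact hx.symm
      simp [hp₀, hx, this, hf x]
    · have h2 : c (c x) = x := by
        have := pcA' x hx
        rw [pA' _ (hcA' x hx)] at this
        simpa using this
      simp [hp₀, hx, hcA' x hx, h2]
  have p₀moved : moved p₀ = sideMoved p false := by
    ext x
    simp only [moved, sideMoved, Finset.mem_filter, Finset.mem_univ, true_and]
    by_cases hx : x ∈ A
    · simp only [hp₀, if_pos hx, pA x hx]
      simpa using (hfA x).2 hx
    · simp only [hp₀, if_neg hx, pA' x hx]
      simp
  obtain ⟨C₀, hC₀, hpC₀, hGC₀, hl₀⟩ := ih p₀ p₀inv (by rw [p₀moved]; exact hK _)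
  have hfC : ∀ x, f x ≠ x → C₀.Adj x (f x) := by
    intro x hx
    have hxA := (hfA x).1 hx
    have : p₀ x = f x := by simp [hp₀, hxA]
    rw [← this]
    exact hpC₀ x (by rwa [this])
  obtain ⟨L, hLinv, hL, hLr⟩ := exists_endpoint_pairing hC₀.isCycles hf hfC
  have hLA : ∀ x ∈ A, L x ∈ A := by
    intro x hx
    rw [← hfA, ← hL] at hx ⊢
    rw [hLinv x]; exact hx.symm
  have pT : ∀ y, (p (true, y)).1 = false → ∃ a ∈ A, y = c a := by
    intro y hy
    have h1 : p (false, (p (true, y)).2) = (true, y) := by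
      have : (false, (p (true, y)).2) = p (true, y) := Prod.ext hy.symm rfl
      rw [this, hp]
    exact ⟨(p (true, y)).2, by rw [memA, h1], by simp only [hc, h1]⟩
  set q : W → W := fun y => if (p (true, y)).1 = false then c (L (p (true, y)).2) else y with hq
  set p₁ : W → W := fun y =>
    if (p (true, y)).1 = false then c (L (p (true, y)).2) else (p (true, y)).2 with hp₁
  have qc : ∀ a ∈ A, q (c a) = c (L a) := by intro a ha; simp [hq, pcA a ha]
  have p₁c : ∀ a ∈ A, p₁ (c a) = c (L a) := by intro a ha; simp [hp₁, pcA a ha]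
  have q' : ∀ y, (p (true, y)).1 ≠ false → q y = y := by intro y hy; simp [hq, hy]
  have p₁' : ∀ y, (p (true, y)).1 ≠ false → p (true, y) = (true, p₁ y) := by
    intro y hy
    refine Prod.ext (by simpa using hy) ?_
    simp only [hp₁, if_neg hy]
  have qinv : Function.Involutive q := by
    intro y
    by_cases hy : (p (true, y)).1 = false
    · obtain ⟨a, ha, rfl⟩ := pT y hy
      rw [qc a ha, qc _ (hLA a ha), hLinv]
    · rw [q' y hy, q' y hy]
  have p₁inv : Function.Involutive p₁ := by
    intro y
    by_cases hy : (p (true, y)).1 = false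
    · obtain ⟨a, ha, rfl⟩ := pT y hy
      rw [p₁c a ha, p₁c _ (hLA a ha), hLinv]
    · have h1 := p₁' y hy
      have h2 : p (true, p₁ y) = (true, y) := by rw [← h1, hp]
      have h3 := p₁' (p₁ y) (by rw [h2]; simp)
      rw [h2] at h3
      simpa using h3.symm
  have hcL : ∀ a ∈ A, c (L a) ≠ c a := by
    intro a ha h
    exact (hL a).2 ((hfA a).2 ha) (hcinj _ (hLA a ha) _ ha h)
  have p₁moved : moved p₁ = sideMoved p true := by
    ext y
    simp only [moved, sideMoved, Finset.mem_filter, Finset.mem_univ, true_and]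
    by_cases hy : (p (true, y)).1 = false
    · obtain ⟨a, ha, rfl⟩ := pT y hy
      rw [p₁c a ha, pcA a ha]
      simpa using hcL a ha
    · rw [p₁' y hy]
      simp
  obtain ⟨C₁, hC₁, hpC₁, hGC₁, hl₁⟩ := ih p₁ p₁inv (by rw [p₁moved]; exact hK _)
  have hqA : ∀ y, q y ≠ y → ∃ a ∈ A, y = c a := by
    intro y hy
    exact pT y (by by_contra h; exact hy (q' y h))
  refine ⟨splice C₀ C₁ f q c, splice_isSingleCycle hC₀ hC₁ hf qinv hfC ?_ hL ?_ hLr ?_ ?_ ?_ ?_,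
    ?_, ?_, ?_⟩
  · intro y hy
    obtain ⟨a, ha, rfl⟩ := hqA y hy
    rw [qc a ha, ← p₁c a ha]
    exact hpC₁ _ (by rw [p₁c a ha]; exact hcL a ha)
  · exact fun x hx => (hfA _).2 (hLA x ((hfA x).1 hx))
  · exact fun x y hx hy => hcinj x ((hfA x).1 hx) y ((hfA y).1 hy)
  · exact fun x hx => qc x ((hfA x).1 hx)
  · intro y hy
    obtain ⟨a, ha, rfl⟩ := hqA y hy
    exact ⟨a, (hfA a).2 ha, rfl⟩
  · obtain ⟨a, ha⟩ := hne
    exact ⟨a, (hfA a).2 ha⟩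
  · rintro ⟨_ | _, x⟩ hx
    · by_cases hxA : x ∈ A
      · rw [pA x hxA]
        exact ⟨(hfA x).2 hxA, rfl⟩
      · rw [pA' x hxA] at hx ⊢
        have h1 : p₀ x = c x := by simp [hp₀, hxA]
        have h2 : c x ≠ x := by simpa using hx
        refine (cut_adj hf).2 ⟨by rw [← h1]; exact hpC₀ x (by rwa [h1]), ?_⟩
        intro h
        exact hxA ((hfA x).1 (by rw [h]; exact h2))
    · by_cases hy : (p (true, x)).1 = false
      · obtain ⟨a, ha, rfl⟩ := pT x hy
        rw [pcA a ha]
        exact ⟨(hfA a).2 ha, rfl⟩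
      · rw [p₁' x hy] at hx ⊢
        have h2 : p₁ x ≠ x := by simpa using hx
        exact (cut_adj qinv).2 ⟨hpC₁ x h2, by rw [q' x hy]; exact h2.symm⟩
  · rintro ⟨_ | _, x⟩ ⟨_ | _, y⟩ hxy
    · obtain ⟨h1, h2⟩ := (cut_adj hf).1 hxy
      rcases hGC₀ x y h1 with h | h
      · left
        by_cases hxA : x ∈ A
        · exact absurd (by simpa [hp₀, hxA] using h) h2
        · rw [pA' x hxA, ← h]; simp [hp₀, hxA]
      · exact Or.inr (Or.inl ⟨rfl, h⟩)
    · obtain ⟨h1, rfl⟩ := hxy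
      exact Or.inl (pA x ((hfA x).1 h1))
    · obtain ⟨h1, rfl⟩ := hxy
      exact Or.inl (pcA y ((hfA y).1 h1))
    · obtain ⟨h1, h2⟩ := (cut_adj qinv).1 hxy
      rcases hGC₁ x y h1 with h | h
      · left
        by_cases hx : (p (true, x)).1 = false
        · obtain ⟨a, ha, rfl⟩ := pT x hx
          exact absurd (by rw [qc a ha, ← p₁c a ha, h]) h2
        · rw [p₁' x hx, h]
      · exact Or.inr (Or.inl ⟨rfl, h⟩)
  · have := add_ncard_support_le_splice (c := c) hC₀.isCycles hC₁.isCycles hf qinv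
    omega

/-- If an odd number of pairs crosses between the two copies of the base, the edge between the
two copies of an uncovered vertex serves as a further crossing pair. -/
theorem isExtendable_prism_of_odd {G : SimpleGraph W} {p : Bool × W → Bool × W}
    (hp : Function.Involutive p) {K ℓ : ℕ}
    (ih : ∀ q : W → W, Function.Involutive q → #(moved q) ≤ K → IsExtendable G q ℓ)
    (hK : ∀ b, #(sideMoved p b) + 1 ≤ K) (hodd : Odd #(crossing p false)) {w : W}
    (hw : ∀ b, p (b, w) = (b, w)) : IsExtendable (prism G) p (2 * ℓ) := by
  have hpw : ∀ v, v.2 ≠ w → (p v).2 ≠ w := by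
    intro v hv h
    have h1 : p v = ((p v).1, w) := Prod.ext rfl h
    have h2 := congrArg p h1
    rw [hp, hw] at h2
    exact hv (by rw [h2])
  set p' : Bool × W → Bool × W := fun v => if v.2 = w then (!v.1, w) else p v with hp'
  have hp'w : ∀ b, p' (b, w) = (!b, w) := by simp [hp']
  have hp'n : ∀ v, v.2 ≠ w → p' v = p v := by intro v hv; simp [hp', hv]
  have p'inv : Function.Involutive p' := by
    rintro ⟨b, x⟩
    by_cases hx : x = w
    · subst hx
      rw [hp'w, hp'w, Bool.not_not]
    · rw [hp'n (b, x) hx, hp'n _ (hpw (b, x) hx), hp]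
  have hside : ∀ b, sideMoved p' b = insert w (sideMoved p b) := by
    intro b
    ext x
    simp only [sideMoved, Finset.mem_filter, Finset.mem_univ, true_and, Finset.mem_insert]
    by_cases hx : x = w
    · subst hx
      simp [hp'w]
    · simp [hp'n (b, x) hx, hx]
  have hcross : crossing p' false = insert w (crossing p false) := by
    ext x
    simp only [crossing, Finset.mem_filter, Finset.mem_univ, true_and, Finset.mem_insert]
    by_cases hx : x = w
    · subst hx
      simp [hp'w]
    · simp [hp'n (false, x) hx, hx]
  have hwc : w ∉ crossing p false := by simp [crossing, hw]
  refine IsExtendable.of_extension (isExtendable_prism_of_even p'inv ih (fun b => ?_) ?_ ?_) ?_ ?_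
  · rw [hside]
    exact (Finset.card_insert_le _ _).trans (hK b)
  · rw [hcross]
    exact Finset.insert_nonempty _ _
  · rw [hcross, Finset.card_insert_of_notMem hwc]
    exact hodd.add_one
  · rintro ⟨b, x⟩ hv
    refine hp'n _ fun h => hv ?_
    change x = w at h
    rw [h, hw]
  · rintro ⟨b, x⟩ hv
    by_cases hx : x = w
    · subst hx
      right
      rw [hp'w]
      exact Or.inr ⟨by simp, rfl⟩
    · left
      rw [hp'n (b, x) hx, hv]

/-- On a long enough cycle there is an edge outside a given matching both of whose ends avoid a
given set. -/
lemma exists_adj_avoiding {C : SimpleGraph W} (hC : C.IsCycles) (p : W → W) (B : Finset W)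
    (h : 4 * #B + #(moved p) < 2 * C.support.ncard) :
    ∃ x y, C.Adj x y ∧ p x ≠ y ∧ x ∉ B ∧ y ∉ B := by
  classical
  by_contra! hcon
  have hdeg : ∀ x, #(univ.filter fun y => C.Adj x y) = if x ∈ C.support then 2 else 0 := by
    intro x
    split_ifs with hx
    · obtain ⟨y, hy⟩ := hx
      obtain ⟨b, hb, h⟩ := exists_adj_iff_of_adj hC hy
      rw [Finset.card_eq_two]
      exact ⟨y, b, hb, by ext z; simp [h z]⟩
    · rw [Finset.card_eq_zero, Finset.filter_eq_empty_iff]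
      exact fun y _ hy => hx ⟨y, hy⟩
  have hdeg' : ∀ x, #(univ.filter fun y => C.Adj y x) ≤ 2 := by
    intro x
    simp_rw [C.adj_comm _ x]
    rw [hdeg x]
    split_ifs <;> simp
  -- all ordered pairs of neighbours, and the three kinds to which they belong
  set P : Finset (W × W) := univ.filter fun z => C.Adj z.1 z.2 with hP
  have hPcard : #P = 2 * C.support.ncard := by
    have h1 : #P = ∑ x : W, #(univ.filter fun y => C.Adj x y) := by
      simp_rw [Finset.card_filter]
      rw [hP, Finset.card_filter, Fintype.sum_prod_type]
    rw [h1, Finset.sum_congr rfl fun x _ => hdeg x, ← Finset.sum_filter, Finset.sum_const,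
      smul_eq_mul, mul_comm, Set.ncard_eq_toFinset_card']
    congr 2
    ext; simp
  have hsub : P ⊆ (B.biUnion fun x => (univ.filter fun y => C.Adj x y).image fun y => (x, y)) ∪
      (B.biUnion fun x => (univ.filter fun y => C.Adj y x).image fun y => (y, x)) ∪
      (moved p).image fun x => (x, p x) := by
    rintro ⟨x, y⟩ hxy
    have hxy' : C.Adj x y := (Finset.mem_filter.1 hxy).2
    simp only [Finset.mem_union, Finset.mem_biUnion, Finset.mem_image, Finset.mem_filter,
      Finset.mem_univ, true_and, moved]
    by_cases h1 : p x = y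
    · exact Or.inr ⟨x, by rw [h1]; exact hxy'.ne', by rw [h1]⟩
    · by_cases h2 : x ∈ B
      · exact Or.inl (Or.inl ⟨x, h2, y, hxy', rfl⟩)
      · exact Or.inl (Or.inr ⟨y, hcon x y hxy' h1 h2, x, hxy', rfl⟩)
  have e1 : #(B.biUnion fun x => (univ.filter fun y => C.Adj x y).image fun y => (x, y))
      ≤ #B * 2 := by
    refine Finset.card_biUnion_le_card_mul _ _ _ fun x _ => Finset.card_image_le.trans ?_
    rw [hdeg x]
    split_ifs <;> simp
  have e2 : #(B.biUnion fun x => (univ.filter fun y => C.Adj y x).image fun y => (y, x))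
      ≤ #B * 2 :=
    Finset.card_biUnion_le_card_mul _ _ _ fun x _ => Finset.card_image_le.trans (hdeg' x)
  have e3 : #((moved p).image fun x => (x, p x)) ≤ #(moved p) := Finset.card_image_le
  have := (Finset.card_le_card hsub).trans ((Finset.card_union_le _ _).trans
    (Nat.add_le_add_right (Finset.card_union_le _ _) _))
  omega

/-- If no pair crosses between the two copies of the base, a cycle for the first copy is found
first; one of its edges whose copy is uncovered is added to the matching in the second copy. -/
theorem isExtendable_prism_of_crossing_eq_empty {G : SimpleGraph W} {p : Bool × W → Bool × W}
    (hp : Function.Involutive p) {K ℓ : ℕ}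
    (ih : ∀ q : W → W, Function.Involutive q → #(moved q) ≤ K → IsExtendable G q ℓ)
    (h0 : #(sideMoved p false) ≤ K) (h1 : #(sideMoved p true) + 2 ≤ K)
    (hcross : ∀ v, (p v).1 = v.1)
    (hlen : 4 * #(sideMoved p true) + #(sideMoved p false) < 2 * ℓ) :
    IsExtendable (prism G) p (2 * ℓ) := by
  set r : Bool → W → W := fun b x => (p (b, x)).2 with hr
  have pr : ∀ b x, p (b, x) = (b, r b x) := fun b x => Prod.ext (hcross _) rfl
  have rinv : ∀ b, Function.Involutive (r b) := by
    intro b x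
    have := hp (b, x)
    rw [pr, pr] at this
    simpa using this
  have rmoved : ∀ b, moved (r b) = sideMoved p b := by
    intro b
    ext x
    simp [moved, sideMoved, pr]
  obtain ⟨C₀, hC₀, hpC₀, hGC₀, hl₀⟩ := ih (r false) (rinv false) (by rwa [rmoved])
  obtain ⟨x, y, hxy, hrxy, hx, hy⟩ := exists_adj_avoiding hC₀.isCycles (r false)
    (sideMoved p true) (by rw [rmoved]; omega)
  have hx' : r true x = x := by simpa [sideMoved, pr] using hx
  have hy' : r true y = y := by simpa [sideMoved, pr] using hy
  set f : W → W := ⇑(Equiv.swap x y) with hf'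
  have hf : Function.Involutive f := fun z => Equiv.swap_apply_self x y z
  have hfm : ∀ z, f z ≠ z ↔ z = x ∨ z = y := by
    intro z
    rw [hf', Equiv.swap_apply_ne_self_iff]
    exact and_iff_right hxy.ne
  have hfC : ∀ z, f z ≠ z → C₀.Adj z (f z) := by
    intro z hz
    rcases (hfm z).1 hz with rfl | rfl
    · rw [hf', Equiv.swap_apply_left]; exact hxy
    · rw [hf', Equiv.swap_apply_right]; exact hxy.symm
  obtain ⟨L, hLinv, hL, hLr⟩ := exists_endpoint_pairing hC₀.isCycles hf hfC
  have hrL : ∀ z, L z ≠ z → r true z = z := by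
    intro z hz
    rw [hL, hfm] at hz
    rcases hz with rfl | rfl <;> assumption
  have hLL : ∀ z, L z ≠ z → L (L z) ≠ L z := fun z hz => by rw [hLinv]; exact hz.symm
  set p₁ : W → W := fun z => if L z ≠ z then L z else r true z with hp₁
  have p₁L : ∀ z, L z ≠ z → p₁ z = L z := by intro z hz; simp [hp₁, hz]
  have p₁r : ∀ z, L z = z → p₁ z = r true z := by intro z hz; simp [hp₁, hz]
  have p₁inv : Function.Involutive p₁ := by
    intro z
    by_cases hz : L z = z
    · have : L (r true z) = r true z := by
        by_contra h
        have h' := hrL _ h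
        rw [rinv] at h'
        rw [← h'] at h
        exact h hz
      rw [p₁r z hz, p₁r _ this, rinv]
    · rw [p₁L z hz, p₁L _ (hLL z hz), hLinv]
  have p₁moved : #(moved p₁) ≤ K := by
    have : moved p₁ ⊆ insert x (insert y (sideMoved p true)) := by
      intro z hz
      have hz' : p₁ z ≠ z := (Finset.mem_filter.1 hz).2
      rw [Finset.mem_insert, Finset.mem_insert, ← or_assoc, ← hfm, ← hL]
      by_cases h : L z = z
      · rw [p₁r z h] at hz'
        right
        simpa [sideMoved, pr] using hz'
      · exact Or.inl h
    have h2 := (Finset.card_le_card this).trans ((Finset.card_insert_le _ _).trans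
      (Nat.add_le_add_right (Finset.card_insert_le _ _) 1))
    omega
  obtain ⟨C₁, hC₁, hpC₁, hGC₁, hl₁⟩ := ih p₁ p₁inv p₁moved
  refine ⟨splice C₀ C₁ f L id, splice_isSingleCycle hC₀ hC₁ hf hLinv hfC ?_ hL ?_ hLr ?_ ?_ ?_ ?_,
    ?_, ?_, ?_⟩
  · intro z hz
    have := hpC₁ z (by rwa [p₁L z hz])
    rwa [p₁L z hz] at this
  · exact fun z hz => (hL _).1 (hLL z ((hL z).2 hz))
  · exact fun z z' _ _ h => h
  · exact fun z _ => rfl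
  · exact fun z hz => ⟨z, (hL z).1 hz, rfl⟩
  · exact ⟨x, (hfm x).2 (Or.inl rfl)⟩
  · rintro ⟨_ | _, z⟩ hz
    · rw [pr] at hz ⊢
      have hz' : r false z ≠ z := by simpa using hz
      refine (cut_adj hf).2 ⟨hpC₀ z hz', fun h => ?_⟩
      rcases (hfm z).1 (by rwa [h]) with rfl | rfl
      · rw [hf', Equiv.swap_apply_left] at h
        exact hrxy h.symm
      · rw [hf', Equiv.swap_apply_right] at h
        exact hrxy (by rw [h, rinv])
    · rw [pr] at hz ⊢
      have hz' : r true z ≠ z := by simpa using hz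
      have hLz : L z = z := by
        by_contra h
        exact hz' (hrL z h)
      refine (cut_adj hLinv).2 ⟨?_, by rw [hLz]; exact hz'.symm⟩
      have := hpC₁ z (by rwa [p₁r z hLz])
      rwa [p₁r z hLz] at this
  · rintro ⟨_ | _, z⟩ ⟨_ | _, z'⟩ hzz
    · obtain ⟨h1, h2⟩ := (cut_adj hf).1 hzz
      rcases hGC₀ z z' h1 with h | h
      · left; rw [pr, h]
      · exact Or.inr (Or.inl ⟨rfl, h⟩)
    · obtain ⟨h1, rfl⟩ := hzz
      exact Or.inr (Or.inr ⟨by simp, rfl⟩)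
    · obtain ⟨h1, rfl⟩ := hzz
      exact Or.inr (Or.inr ⟨by simp, rfl⟩)
    · obtain ⟨h1, h2⟩ := (cut_adj hLinv).1 hzz
      rcases hGC₁ z z' h1 with h | h
      · by_cases hLz : L z = z
        · left; rw [pr, ← h, p₁r z hLz]
        · exact absurd (by rw [← h, p₁L z hLz]) h2
      · exact Or.inr (Or.inl ⟨rfl, h⟩)
  · have := add_ncard_support_le_splice (c := id) hC₀.isCycles hC₁.isCycles hf hLinv
    omega

end Prism

/-! ### The cube of dimension three -/

/-- Whether two numbers below `8` differ in exactly one binary digit. -/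
def bitAdj (u v : ℕ) : Bool :=
  Nat.beq (u ^^^ v) 1 || Nat.beq (u ^^^ v) 2 || Nat.beq (u ^^^ v) 4

/-- Whether `v` may follow the values `l = [p 0, …, p (k - 1)]` of an involution `p`. -/
def isCompatible (k : ℕ) (l : List ℕ) (v : ℕ) : Bool :=
  if l.any (Nat.beq k) then Nat.blt v k && Nat.beq (l.getD v 0) k
  else Nat.ble k v && !l.any (Nat.beq v)

/-- The possible lists `[p 0, …, p (k - 1)]` for involutions `p` of `{0, …, 7}`. -/
def involutionLists : ℕ → List (List ℕ)
  | 0 => [[]]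
  | k + 1 => (involutionLists k).flatMap fun l =>
      ((List.range 8).filter fun v => isCompatible k l v).map fun v => l ++ [v]

lemma map_range_mem_involutionLists {p : ℕ → ℕ} (hp : Function.Involutive p)
    (hp8 : ∀ i < 8, p i < 8) {k : ℕ} (hk : k ≤ 8) : (List.range k).map p ∈ involutionLists k := by
  induction k with
  | zero => simp [involutionLists]
  | succ k ih =>
    have hget : ∀ i < k, ((List.range k).map p).getD i 0 = p i := by
      intro i hi
      simp [List.getD, hi]
    simp only [involutionLists, List.mem_flatMap, List.mem_map, List.mem_filter, List.mem_range]
    refine ⟨_, ih (by omega), p k, ⟨hp8 k (by omega), ?_⟩, by simp [List.range_succ]⟩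
    have hany : ∀ m, ((List.range k).map p).any (Nat.beq m) = true ↔ p m < k := by
      intro m
      simp only [List.any_map, List.any_eq_true, List.mem_range, Function.comp_apply, Nat.beq_eq]
      exact ⟨fun ⟨i, hi, h⟩ => by rwa [h, hp], fun h => ⟨p m, h, (hp m).symm⟩⟩
    rw [isCompatible]
    split_ifs with h
    · rw [hany] at h
      simp [hp k, h]
    · rw [hany, not_lt] at h
      have : ¬ p (p k) < k := by simp [hp k]
      rw [← hany, Bool.not_eq_true] at this
      simp [this, h]

/-- Depth-first search for a cycle with at least six vertices that contains the pairs `{v, p v}`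
and otherwise edges of the cube, where `p` is given by its list of values. The path is
listed from its current end; `forced` records that the last step was along an edge of the cube. -/
def searchCycle (p : List ℕ) : ℕ → Bool → List ℕ → Option (List ℕ)
  | 0, _, _ => none
  | _ + 1, _, [] => none
  | n + 1, forced, v :: path =>
    let w := p.getD v 0
    if forced && !Nat.beq w v then
      if (v :: path).any (Nat.beq w) then none else searchCycle p n false (w :: v :: path)
    else if Nat.ble 6 (v :: path).length && bitAdj v ((v :: path).getLastD 0) &&
        (List.range 8).all (fun u => Nat.beq (p.getD u 0) u || (v :: path).any (Nat.beq u)) then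
      some (v :: path)
    else
      [v ^^^ 1, v ^^^ 2, v ^^^ 4].findSome? fun u =>
        if (v :: path).any (Nat.beq u) then none else searchCycle p n true (u :: v :: path)

/-- The search, started with a pair of the matching if there is one. -/
def findCycle (p : List ℕ) : Option (List ℕ) :=
  match (List.range 8).find? fun v => !Nat.beq (p.getD v 0) v with
  | some v => searchCycle p 9 false [p.getD v 0, v]
  | none => searchCycle p 9 false [0]

/-- Whether the closed polygon `c` has at least six vertices, contains the pairs `{v, p v}`, and
has otherwise edges of the cube. -/
def isGoodCycle (p c : List ℕ) : Bool :=
  Nat.ble 6 c.length && c.all (fun v => Nat.ble v 7) && decide c.Nodup &&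
  (List.range c.length).all (fun i =>
    Nat.beq (p.getD (c.getD i 0) 0) (c.getD ((i + 1) % c.length) 0) ||
    bitAdj (c.getD i 0) (c.getD ((i + 1) % c.length) 0)) &&
  (List.range 8).all (fun v => Nat.beq (p.getD v 0) v || (List.range c.length).any fun i =>
    (Nat.beq (c.getD i 0) v && Nat.beq (c.getD ((i + 1) % c.length) 0) (p.getD v 0)) ||
    (Nat.beq (c.getD i 0) (p.getD v 0) && Nat.beq (c.getD ((i + 1) % c.length) 0) v))

lemma forall_involutionLists_isGoodCycle :
    (involutionLists 8).all (fun p => (findCycle p).any (isGoodCycle p)) = true := by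
  decide +kernel

/-- The vertices of the cube of dimension three, numbered in binary. -/
def cubeThreeEquiv : (Fin 3 → Bool) ≃ Fin 8 where
  toFun u := ⟨(u 0).toNat + 2 * (u 1).toNat + 4 * (u 2).toNat, by
    have := (u 0).toNat_le; have := (u 1).toNat_le; have := (u 2).toNat_le; omega⟩
  invFun i := fun k => i.val.testBit k
  left_inv := by decide
  right_inv := by decide

lemma hammingDist_eq_one_of_bitAdj : ∀ u v : Fin 3 → Bool,
    bitAdj (cubeThreeEquiv u) (cubeThreeEquiv v) = true → hammingDist u v = 1 := by
  decide +kernel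

/-- In dimension three every matching of the complete graph extends to a cycle that misses at most
two vertices. -/
theorem isExtendable_three (p : (Fin 3 → Bool) → (Fin 3 → Bool)) (hp : Function.Involutive p) :
    IsExtendable (hypercube 3) p 6 := by
  let G : SimpleGraph (Fin 8) := SimpleGraph.fromRel fun u v => bitAdj u v = true
  have hG : ∀ u v : Fin 8, bitAdj u v = true → u ≠ v → G.Adj u v :=
    fun u v h huv => (SimpleGraph.fromRel_adj _ _ _).2 ⟨huv, Or.inl h⟩
  refine IsExtendable.of_equiv (G' := G) cubeThreeEquiv (fun u v huv => ?_) ?_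
  · rcases ((SimpleGraph.fromRel_adj _ _ _).1 huv).2 with h | h
    · exact hammingDist_eq_one_of_bitAdj u v h
    · exact (hypercube 3).symm.symm _ _ (hammingDist_eq_one_of_bitAdj v u h)
  set r : Fin 8 → Fin 8 := fun v => cubeThreeEquiv (p (cubeThreeEquiv.symm v)) with hr
  have rinv : Function.Involutive r := by
    intro v
    simp only [hr, Equiv.symm_apply_apply]
    rw [hp, Equiv.apply_symm_apply]
  clear_value r
  set P : ℕ → ℕ := fun i => if h : i < 8 then r ⟨i, h⟩ else i with hP
  have Pr : ∀ v : Fin 8, P v = r v := fun v => by simp [hP]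
  have P8 : ∀ i < 8, P i < 8 := by
    intro i hi
    simp [hP, hi]
  have Pinv : Function.Involutive P := by
    intro i
    by_cases hi : i < 8
    · have h1 : P i = r ⟨i, hi⟩ := Pr ⟨i, hi⟩
      rw [h1, Pr, rinv]
    · simp [hP, hi]
  have hget : ∀ i < 8, ((List.range 8).map P).getD i 0 = P i := by
    intro i hi
    simp [List.getD, hi]
  have key := List.all_eq_true.1 forall_involutionLists_isGoodCycle _
    (map_range_mem_involutionLists Pinv P8 le_rfl)
  obtain ⟨c, -, hc⟩ := (Option.any_eq_true _ _).1 key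
  simp only [isGoodCycle, Bool.and_eq_true, List.all_eq_true, decide_eq_true_eq, List.mem_range,
    Bool.or_eq_true, Nat.beq_eq, Nat.ble_eq, List.any_eq_true] at hc
  obtain ⟨⟨⟨⟨hlen, hc8⟩, hnodup⟩, hstep⟩, hcover⟩ := hc
  have : NeZero c.length := ⟨by omega⟩
  have hcget : ∀ i (hi : i < c.length), c.getD i 0 = c.get ⟨i, hi⟩ := by
    intro i hi
    simp [List.getD, hi]
  set g : Fin c.length → Fin 8 := fun i =>
    ⟨c.get i, Nat.lt_succ_of_le (hc8 _ (List.get_mem _ _))⟩ with hg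
  have ginj : Function.Injective g := by
    intro i j h
    exact hnodup.injective_get (congrArg Fin.val h)
  have gval : ∀ i : Fin c.length, c.getD i 0 = g i := fun i => hcget i i.2
  have gval' : ∀ i : Fin c.length, c.getD ((i + 1) % c.length) 0 = g (i + 1) := by
    intro i
    rw [← gval, Fin.val_add, Fin.val_one', Nat.add_mod_mod]
  have hstep' : ∀ i, r (g i) = g (i + 1) ∨ bitAdj (g i) (g (i + 1)) = true := by
    intro i
    have := hstep i i.2
    rw [gval, gval', hget _ (g i).2, Pr] at this
    exact this.imp Fin.ext id
  refine ⟨polygon g (by omega) ginj, polygon_isSingleCycle g (by omega) ginj, ?_, ?_, ?_⟩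
  · intro v hv
    rcases hcover v v.2 with h | ⟨i, hi, h⟩
    · rw [hget _ v.2, Pr] at h
      exact absurd (Fin.ext h) hv
    · have e1 := gval ⟨i, hi⟩
      have e2 := gval' ⟨i, hi⟩
      simp only at e1 e2
      rw [hget _ v.2, Pr, e1, e2] at h
      refine ⟨⟨i, hi⟩, h.imp ?_ ?_⟩
      · exact fun h => ⟨Fin.ext h.1.symm, Fin.ext h.2.symm⟩
      · exact fun h => ⟨Fin.ext h.1.symm, Fin.ext h.2.symm⟩
  · intro u v huv
    have hne := huv.ne
    obtain ⟨i, ⟨rfl, rfl⟩ | ⟨rfl, rfl⟩⟩ := huv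
    · exact (hstep' i).imp id fun h => hG _ _ h hne
    · refine (hstep' i).imp (fun h => by rw [← h, rinv]) fun h => (hG _ _ h hne.symm).symm
  · rw [polygon_support g (by omega) ginj, ← Set.image_univ, Set.ncard_image_of_injective _ ginj,
      Set.ncard_univ, Nat.card_fin]
    exact hlen

/-! ### Splitting the cube along a direction -/

lemma even_card_of_involutive {V : Type*} {p : V → V} (hp : Function.Involutive p)
    {A : Finset V} (hA : ∀ v ∈ A, p v ∈ A) (hpA : ∀ v ∈ A, p v ≠ v) : Even #A := by
  have h : ∑ v ∈ A, (1 : ZMod 2) = 0 :=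
    Finset.sum_involution (fun v _ => p v) (fun _ _ => by decide) (fun v hv _ => hpA v hv)
      (fun v hv => hA v hv) (fun v _ => hp v)
  rw [Finset.sum_const, nsmul_one] at h
  exact (ZMod.natCast_eq_zero_iff_even).1 h

section Transport

variable {V W : Type*} [Fintype V] [DecidableEq V] [Fintype W] [DecidableEq W]

lemma card_sideMoved_conj (e : V ≃ Bool × W) (p : V → V) (c : Bool) :
    #(sideMoved (fun x => e (p (e.symm x))) c) = #((moved p).filter fun v => (e v).1 = c) := by
  refine Finset.card_nbij' (fun x => e.symm (c, x)) (fun v => (e v).2) ?_ ?_ ?_ ?_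
  · intro x hx
    have hx' : e (p (e.symm (c, x))) ≠ (c, x) := by simpa [sideMoved] using hx
    simpa [moved, Equiv.eq_symm_apply] using hx'
  · intro v hv
    obtain ⟨h1, h2⟩ : p v ≠ v ∧ (e v).1 = c := by simpa [moved] using hv
    have : (c, (e v).2) = e v := Prod.ext h2.symm rfl
    simpa [sideMoved, this] using h1
  · intro x _
    simp
  · intro v hv
    obtain ⟨-, h2⟩ : p v ≠ v ∧ (e v).1 = c := by simpa [moved] using hv
    have : (c, (e v).2) = e v := Prod.ext h2.symm rfl
    simp [this]

lemma even_card_crossing_iff {p : Bool × W → Bool × W} (hp : Function.Involutive p) (b : Bool) :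
    Even #(crossing p b) ↔ Even #(sideMoved p b) := by
  have hsub : crossing p b ⊆ sideMoved p b := by
    intro x hx
    have : (p (b, x)).1 ≠ b := by simpa [crossing] using hx
    simp only [sideMoved, Finset.mem_filter, Finset.mem_univ, true_and]
    exact fun h => this (by rw [h])
  have hpb : ∀ x, x ∈ sideMoved p b \ crossing p b ↔
      p (b, x) = (b, (p (b, x)).2) ∧ (p (b, x)).2 ≠ x := by
    intro x
    simp only [sideMoved, crossing, Finset.mem_sdiff, Finset.mem_filter, Finset.mem_univ, true_and,
      not_not]
    constructor
    · rintro ⟨h1, h2⟩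
      exact ⟨Prod.ext h2 rfl, fun h => h1 (Prod.ext h2 h)⟩
    · rintro ⟨h1, h2⟩
      exact ⟨fun h => h2 (by rw [h]), by rw [h1]⟩
  have h : Even #(sideMoved p b \ crossing p b) := by
    refine even_card_of_involutive
      (p := fun x => if p (b, x) = (b, (p (b, x)).2) then (p (b, x)).2 else x) ?_ ?_ ?_
    · intro x
      by_cases hx : p (b, x) = (b, (p (b, x)).2)
      · have h2 : p (b, (p (b, x)).2) = (b, x) := by rw [← hx, hp]
        simp only [if_pos hx, h2, if_true]
      · simp only [if_neg hx]
    · intro x hx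
      obtain ⟨h1, h2⟩ := (hpb x).1 hx
      simp only [if_pos h1]
      have h3 : p (b, (p (b, x)).2) = (b, x) := by rw [← h1, hp]
      rw [hpb, h3]
      exact ⟨rfl, h2.symm⟩
    · intro x hx
      obtain ⟨h1, h2⟩ := (hpb x).1 hx
      simpa only [if_pos h1] using h2
  rw [Finset.card_sdiff_of_subset hsub, Nat.even_sub (Finset.card_le_card hsub)] at h
  exact h.symm

end Transport

section Cube

variable {n : ℕ}

/-- The cube of dimension `n + 1` as two copies of the cube of dimension `n`, distinguished by the
coordinate `d`; the copy of the vertices `u` with `u d = b` is the one labelled `false`. -/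
def splitEquiv (d : Fin (n + 1)) (b : Bool) : (Fin (n + 1) → Bool) ≃ Bool × (Fin n → Bool) where
  toFun u := (u d ^^ b, d.removeNth u)
  invFun z := d.insertNth (z.1 ^^ b) z.2
  left_inv u := by simp
  right_inv z := by simp

lemma hammingDist_succAbove (d : Fin (n + 1)) (u v : Fin (n + 1) → Bool) :
    hammingDist u v =
      (if u d ≠ v d then 1 else 0) + hammingDist (d.removeNth u) (d.removeNth v) := by
  simp only [hammingDist, Finset.card_filter]
  rw [Fin.sum_univ_succAbove _ d]
  rfl

lemma hypercube_adj_of_prism_adj (d : Fin (n + 1)) (b : Bool) (u v : Fin (n + 1) → Bool)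
    (h : (prism (hypercube n)).Adj (splitEquiv d b u) (splitEquiv d b v)) :
    (hypercube (n + 1)).Adj u v := by
  change hammingDist u v = 1
  rw [hammingDist_succAbove d]
  rcases h with ⟨h1, h2⟩ | ⟨h1, h2⟩
  · have h1' : u d = v d := by simpa [splitEquiv] using h1
    have h2' : hammingDist (d.removeNth u) (d.removeNth v) = 1 := h2
    rw [if_neg (not_not.2 h1'), h2']
  · have h1' : u d ≠ v d := by simpa [splitEquiv] using h1
    have h2' : d.removeNth u = d.removeNth v := h2
    rw [if_pos h1', h2', hammingDist_self]

/-- The number of vertices `v` with `v d = b` that the matching `p` covers. -/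
def sideCount (p : (Fin n → Bool) → (Fin n → Bool)) (d : Fin n) (b : Bool) : ℕ :=
  #((moved p).filter fun v => v d = b)

lemma sideCount_add (p : (Fin n → Bool) → (Fin n → Bool)) (d : Fin n) (b : Bool) :
    sideCount p d b + sideCount p d (!b) = #(moved p) := by
  rw [← Finset.card_filter_add_card_filter_not (s := moved p) (fun v => v d = b), sideCount,
    sideCount]
  congr 3
  ext v
  simp [Bool.eq_not]

lemma card_sideMoved_split (p : (Fin (n + 1) → Bool) → (Fin (n + 1) → Bool)) (d : Fin (n + 1))
    (b c : Bool) :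
    #(sideMoved (fun x => splitEquiv d b (p ((splitEquiv d b).symm x))) c) =
      sideCount p d (c ^^ b) := by
  rw [card_sideMoved_conj, sideCount]
  congr 1
  ext v
  rw [Finset.mem_filter, Finset.mem_filter]
  refine and_congr_right fun _ => ?_
  change (v d ^^ b) = c ↔ _
  cases v d <;> cases b <;> cases c <;> simp

lemma involutive_conj {V V' : Type*} (e : V ≃ V') {p : V → V} (hp : Function.Involutive p) :
    Function.Involutive fun x => e (p (e.symm x)) := by
  intro x
  simp only [Equiv.symm_apply_apply]
  rw [hp, Equiv.apply_symm_apply]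

variable {p : (Fin (n + 1) → Bool) → (Fin (n + 1) → Bool)} {K ℓ : ℕ}

lemma crossing_nonempty (d : Fin (n + 1)) (hp : Function.Involutive p) {v : Fin (n + 1) → Bool}
    (hv : p v d ≠ v d) :
    (crossing (fun x => splitEquiv d false (p ((splitEquiv d false).symm x))) false).Nonempty := by
  wlog h : v d = false generalizing v
  · refine this (v := p v) (by rw [hp]; exact hv.symm) ?_
    rw [Bool.not_eq_false] at h
    rw [h] at hv
    simpa using hv
  · refine ⟨(splitEquiv d false v).2, ?_⟩
    simp only [crossing, Finset.mem_filter, Finset.mem_univ, true_and]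
    have h1 : (false, (splitEquiv d false v).2) = splitEquiv d false v :=
      Prod.ext (by simp [splitEquiv, h]) rfl
    rw [h1, Equiv.symm_apply_apply]
    rw [h] at hv
    simpa [splitEquiv] using hv

theorem isExtendable_succ_of_even (hp : Function.Involutive p)
    (ih : ∀ q : (Fin n → Bool) → (Fin n → Bool), Function.Involutive q → #(moved q) ≤ K →
      IsExtendable (hypercube n) q ℓ)
    (d : Fin (n + 1)) (hK : ∀ b, sideCount p d b ≤ K) (hcross : ∃ v, p v d ≠ v d)
    (heven : Even (sideCount p d false)) : IsExtendable (hypercube (n + 1)) p (2 * ℓ) := by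
  refine IsExtendable.of_equiv (splitEquiv d false) (hypercube_adj_of_prism_adj d false) ?_
  obtain ⟨v, hv⟩ := hcross
  refine isExtendable_prism_of_even (involutive_conj _ hp) ih (fun b => ?_)
    (crossing_nonempty d hp hv) ?_
  · rw [card_sideMoved_split]
    exact hK _
  · rw [even_card_crossing_iff (involutive_conj _ hp), card_sideMoved_split]
    exact heven

/-- The vertex that differs from `v` in the coordinate `d` only. -/
def flip (d : Fin n) (v : Fin n → Bool) : Fin n → Bool := Function.update v d (!v d)

lemma flip_involutive (d : Fin n) : Function.Involutive (flip d) := by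
  intro v
  simp [flip]

lemma splitEquiv_symm_eq (d : Fin (n + 1)) (b c : Bool) (v : Fin (n + 1) → Bool) :
    (splitEquiv d b).symm (c, d.removeNth v) = v ∨
      (splitEquiv d b).symm (c, d.removeNth v) = flip d v := by
  by_cases h : (c ^^ b) = v d
  · left
    simp [splitEquiv, h]
  · right
    have h' : (c ^^ b) = !v d := by simpa [Bool.eq_not] using h
    simp only [splitEquiv, Equiv.coe_fn_symm_mk, h', flip]
    simp

theorem isExtendable_succ_of_odd (hp : Function.Involutive p)
    (ih : ∀ q : (Fin n → Bool) → (Fin n → Bool), Function.Involutive q → #(moved q) ≤ K →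
      IsExtendable (hypercube n) q ℓ)
    (d : Fin (n + 1)) (hK : ∀ b, sideCount p d b + 1 ≤ K) (hodd : Odd (sideCount p d false))
    (hfree : ∃ v, p v = v ∧ p (flip d v) = flip d v) :
    IsExtendable (hypercube (n + 1)) p (2 * ℓ) := by
  refine IsExtendable.of_equiv (splitEquiv d false) (hypercube_adj_of_prism_adj d false) ?_
  obtain ⟨v, hv, hv'⟩ := hfree
  refine isExtendable_prism_of_odd (involutive_conj _ hp) ih (fun b => ?_) ?_
    (w := d.removeNth v) fun b => ?_
  · rw [card_sideMoved_split]
    exact hK _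
  · rw [← Nat.not_even_iff_odd, even_card_crossing_iff (involutive_conj _ hp),
      card_sideMoved_split, Nat.not_even_iff_odd]
    exact hodd
  · have h : p ((splitEquiv d false).symm (b, d.removeNth v)) =
        (splitEquiv d false).symm (b, d.removeNth v) := by
      rcases splitEquiv_symm_eq d false b v with h | h <;> rw [h] <;> assumption
    simp only [h, Equiv.apply_symm_apply]

theorem isExtendable_succ_of_no_crossing (hp : Function.Involutive p)
    (ih : ∀ q : (Fin n → Bool) → (Fin n → Bool), Function.Involutive q → #(moved q) ≤ K →
      IsExtendable (hypercube n) q ℓ)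
    (d : Fin (n + 1)) (b : Bool) (h0 : sideCount p d b ≤ K) (h1 : sideCount p d (!b) + 2 ≤ K)
    (hcross : ∀ v, p v d = v d) (hlen : 4 * sideCount p d (!b) + sideCount p d b < 2 * ℓ) :
    IsExtendable (hypercube (n + 1)) p (2 * ℓ) := by
  refine IsExtendable.of_equiv (splitEquiv d b) (hypercube_adj_of_prism_adj d b) ?_
  refine isExtendable_prism_of_crossing_eq_empty (involutive_conj _ hp) ih ?_ ?_ (fun v => ?_) ?_
  · rwa [card_sideMoved_split, Bool.false_xor]
  · rwa [card_sideMoved_split, Bool.true_xor]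
  · change (p ((splitEquiv d b).symm v) d ^^ b) = v.1
    rw [hcross]
    exact congrArg Prod.fst ((splitEquiv d b).apply_symm_apply v)
  · rwa [card_sideMoved_split, card_sideMoved_split, Bool.false_xor, Bool.true_xor]

lemma even_sideCount_of_no_crossing (hp : Function.Involutive p) {d : Fin (n + 1)}
    (hcross : ∀ v, p v d = v d) (b : Bool) : Even (sideCount p d b) := by
  refine even_card_of_involutive hp (fun v hv => ?_) fun v hv => ?_
  · obtain ⟨h1, h2⟩ : p v ≠ v ∧ v d = b := by simpa [moved] using hv
    simp only [moved, Finset.mem_filter, Finset.mem_univ, true_and, hcross, h2, and_true]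
    rw [hp]; exact h1.symm
  · exact (Finset.mem_filter.1 (Finset.mem_filter.1 hv).1).2

lemma even_card_moved {V : Type*} [Fintype V] [DecidableEq V] {p : V → V}
    (hp : Function.Involutive p) : Even #(moved p) := by
  refine even_card_of_involutive hp (fun v hv => ?_) fun v hv => (Finset.mem_filter.1 hv).2
  have h1 : p v ≠ v := (Finset.mem_filter.1 hv).2
  simp only [moved, Finset.mem_filter, Finset.mem_univ, true_and]
  rw [hp]; exact h1.symm

/-- If the matching covers fewer vertices than there are edges in direction `d`, some edge in
direction `d` has both ends uncovered. -/
lemma exists_free_edge (d : Fin (n + 1)) (h : #(moved p) < 2 ^ n) :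
    ∃ v, p v = v ∧ p (flip d v) = flip d v := by
  have h1 : #((moved p).image d.removeNth) < Fintype.card (Fin n → Bool) := by
    refine Finset.card_image_le.trans_lt ?_
    simpa using h
  obtain ⟨w, hw⟩ : ∃ w, w ∉ (moved p).image d.removeNth := by
    by_contra! hcon
    rw [Finset.eq_univ_iff_forall.2 hcon, Finset.card_univ] at h1
    exact lt_irrefl _ h1
  have key : ∀ v, d.removeNth v = w → p v = v := by
    intro v hv
    by_contra hp
    exact hw (Finset.mem_image.2 ⟨v, by simp [moved, hp], hv⟩)
  refine ⟨d.insertNth false w, key _ (by simp), key _ ?_⟩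
  simp [flip]

end Cube

/-! ### Choosing the direction -/

/-- The sizes of the smaller sides, summed over all directions, give the sum of the distances to the
vertex of majority coordinates, and only `n + 1` vertices have distance less than two to it. -/
lemma two_mul_card_le_sum_min {n : ℕ} (S : Finset (Fin n → Bool)) :
    2 * #S ≤ ∑ d, min #(S.filter fun v => v d = false) #(S.filter fun v => v d = true) + n + 2 := by
  have hz : ∀ d, ∃ b, min #(S.filter fun v => v d = false) #(S.filter fun v => v d = true) =
      #(S.filter fun v => v d ≠ b) := by
    intro d
    rcases min_choice #(S.filter fun v => v d = false) #(S.filter fun v => v d = true) with h | h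
    · exact ⟨true, by rw [h]; simp⟩
    · exact ⟨false, by rw [h]; simp⟩
  choose z hz using hz
  have h1 : ∑ d, min #(S.filter fun v => v d = false) #(S.filter fun v => v d = true) =
      ∑ v ∈ S, hammingDist v z := by
    simp_rw [hz, hammingDist, Finset.card_filter]
    exact Finset.sum_comm
  have h2 : ∀ v ∈ S, 2 ≤ hammingDist v z + ((if hammingDist v z = 1 then 1 else 0) +
      (if v = z then 2 else 0)) := by
    intro v _
    by_cases hv : v = z
    · simp [hv]
    · have := hammingDist_pos.2 hv
      split_ifs <;> omega
  have h3 : #(S.filter fun v => hammingDist v z = 1) ≤ n := by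
    have : (S.filter fun v => hammingDist v z = 1) ⊆ univ.image fun d => flip d z := by
      intro v hv
      obtain ⟨d, hd⟩ := Finset.card_eq_one.1 (Finset.mem_filter.1 hv).2
      refine Finset.mem_image.2 ⟨d, Finset.mem_univ _, ?_⟩
      have hmem : ∀ i, v i ≠ z i ↔ i = d := by
        intro i
        have := Finset.ext_iff.1 hd i
        simpa using this
      funext i
      by_cases hi : i = d
      · subst hi
        simp only [flip, Function.update_self]
        have := (hmem i).2 rfl
        revert this
        cases v i <;> cases z i <;> simp
      · rw [flip, Function.update_of_ne hi]
        by_contra hne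
        exact hi ((hmem i).1 (Ne.symm hne))
    simpa using (Finset.card_le_card this).trans Finset.card_image_le
  have h4 : #(S.filter fun v => v = z) ≤ 1 :=
    Finset.card_le_one.2 fun a ha b hb =>
      (Finset.mem_filter.1 ha).2.trans (Finset.mem_filter.1 hb).2.symm
  have h5 := Finset.sum_le_sum h2
  rw [Finset.sum_const, smul_eq_mul, Finset.sum_add_distrib, Finset.sum_add_distrib,
    ← Finset.card_filter, ← Finset.sum_filter, Finset.sum_const, smul_eq_mul] at h5
  rw [h1]
  omega

/-- If `m` exceeds `m'` by at most about `2 m / n`, some direction leaves at most `2 m'` of the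
`2 m` covered vertices on each of its sides: otherwise the smaller sides have fewer than `2 (m - m')`
elements each, and their sum contradicts `two_mul_card_le_sum_min`. -/
lemma exists_balanced_direction {n m m' : ℕ} {p : (Fin n → Bool) → (Fin n → Bool)} (hn : 0 < n)
    (hm : #(moved p) = 2 * m) (h : n * m + 2 ≤ n * m' + 2 * m) :
    ∃ d, ∀ b, sideCount p d b ≤ 2 * m' := by
  by_contra! hcon
  have hmm : m' < m := by
    obtain ⟨b, hb⟩ := hcon ⟨0, hn⟩
    have := sideCount_add p ⟨0, hn⟩ b
    omega
  obtain ⟨g, rfl⟩ := Nat.exists_eq_add_of_lt hmm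
  have h1 : ∀ d, min (sideCount p d false) (sideCount p d true) ≤ 2 * g + 1 := by
    intro d
    obtain ⟨b, hb⟩ := hcon d
    have := sideCount_add p d b
    cases b
    · exact (min_le_right _ _).trans (by simp only [Bool.not_false] at this; omega)
    · exact (min_le_left _ _).trans (by simp only [Bool.not_true] at this; omega)
  have h2 := two_mul_card_le_sum_min (moved p)
  have h3 := Finset.sum_le_card_nsmul univ
    (fun d => min (sideCount p d false) (sideCount p d true)) _ fun d _ => h1 d
  rw [Finset.card_univ, Fintype.card_fin, smul_eq_mul] at h3
  simp only [sideCount] at h3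
  rw [hm] at h2
  have h4 : n * (2 * g + 1) = 2 * (n * g) + n := by ring
  have h5 : n * (m' + g + 1) = n * m' + n * g + n := by ring
  omega

/-! ### The cube of dimension four -/

/-- If at most half of the vertices are covered but every edge in direction `d` has a covered end,
then exactly one end of each of these edges is covered. -/
lemma transversal_of_no_free_edge {n : ℕ} {p : (Fin n → Bool) → (Fin n → Bool)} {d : Fin n}
    (hcard : 2 * #(moved p) ≤ 2 ^ n) (h : ∀ v, p v = v → p (flip d v) ≠ flip d v) :
    2 * #(moved p) = 2 ^ n ∧ ∀ v, v ∈ moved p ↔ flip d v ∉ moved p := by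
  have h1 : moved p ∪ (moved p).image (flip d) = univ := by
    refine Finset.eq_univ_iff_forall.2 fun v => ?_
    rw [Finset.mem_union, Finset.mem_image]
    by_cases hv : p v = v
    · exact Or.inr ⟨flip d v, by simpa [moved] using h v hv, flip_involutive d v⟩
    · exact Or.inl (by simpa [moved] using hv)
  have h2 := Finset.card_union_add_card_inter (moved p) ((moved p).image (flip d))
  rw [h1, Finset.card_image_of_injective _ (flip_involutive d).injective, Finset.card_univ] at h2
  have h3 : Fintype.card (Fin n → Bool) = 2 ^ n := by simp
  have h4 : moved p ∩ (moved p).image (flip d) = ∅ := Finset.card_eq_zero.1 (by omega)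
  refine ⟨by omega, fun v => ⟨fun hv hv' => ?_, fun hv => ?_⟩⟩
  · have : v ∈ moved p ∩ (moved p).image (flip d) :=
      Finset.mem_inter.2 ⟨hv, Finset.mem_image.2 ⟨_, hv', flip_involutive d v⟩⟩
    rw [h4] at this
    simp at this
  · by_contra hv'
    have hpv : p v = v := by simpa [moved] using hv'
    have : p (flip d v) = flip d v := by simpa [moved] using hv
    exact h v hpv this

/-- The inductive step can only fail for a direction crossed by an odd number of pairs each of whose
edges has a covered end. If this is the case for all directions crossed by some pair, the covered
vertices form half of the cube, with exactly one vertex on each of these edges; but then the number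
of covered vertices in each half is four, or the only crossed direction contains a pair. -/
theorem isExtendable_four (p : (Fin 4 → Bool) → (Fin 4 → Bool)) (hp : Function.Involutive p)
    (hcard : #(moved p) ≤ 8) : IsExtendable (hypercube 4) p 12 := by
  have ih : ∀ q : (Fin 3 → Bool) → (Fin 3 → Bool), Function.Involutive q → #(moved q) ≤ 16 →
      IsExtendable (hypercube 3) q 6 := fun q hq _ => isExtendable_three q hq
  have hle : ∀ d b, sideCount p d b ≤ 8 := fun d b => (Finset.card_filter_le _ _).trans hcard
  by_cases h0 : ∃ v, p v ≠ v
  swap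
  · push Not at h0
    have h1 : ∀ d b, sideCount p d b = 0 := by
      intro d b
      simp [sideCount, moved, h0]
    exact isExtendable_succ_of_no_crossing hp ih 0 false (by rw [h1]; omega) (by rw [h1]; omega)
      (fun v => by rw [h0]) (by rw [h1, h1]; omega)
  by_contra hcon
  have hodd : ∀ d, (∃ v, p v d ≠ v d) → Odd (sideCount p d false) := by
    intro d hd
    rw [← Nat.not_even_iff_odd]
    exact fun he => hcon (isExtendable_succ_of_even hp ih d (fun b => by have := hle d b; omega)
      hd he)
  have htrans : ∀ d, (∃ v, p v d ≠ v d) →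
      2 * #(moved p) = 2 ^ 4 ∧ ∀ v, v ∈ moved p ↔ flip d v ∉ moved p := by
    intro d hd
    refine transversal_of_no_free_edge (by omega) fun v hv hv' => hcon ?_
    exact isExtendable_succ_of_odd hp ih d (fun b => by have := hle d b; omega) (hodd d hd)
      ⟨v, hv, hv'⟩
  obtain ⟨v, hv⟩ := h0
  obtain ⟨d, hd⟩ : ∃ d, p v d ≠ v d := by
    by_contra! h
    exact hv (funext h)
  obtain ⟨hcard', hd'⟩ := htrans d ⟨v, hd⟩
  by_cases hd2 : ∃ d' ≠ d, ∃ v, p v d' ≠ v d'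
  · -- flipping both coordinates maps the covered vertices on one side to those on the other
    obtain ⟨d', hne, hv'⟩ := hd2
    have key : ∀ b, sideCount p d b ≤ sideCount p d (!b) := by
      intro b
      refine Finset.card_le_card_of_injOn (fun u => flip d (flip d' u)) ?_
        ((flip_involutive d).injective.comp (flip_involutive d').injective).injOn
      intro u hu
      obtain ⟨hu1, hu2⟩ := Finset.mem_filter.1 hu
      refine Finset.mem_coe.2 (Finset.mem_filter.2 ⟨?_, ?_⟩)
      · rw [hd', flip_involutive d]
        exact ((htrans d' hv').2 u).1 hu1
      · simp only [flip, Function.update_self]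
        rw [Function.update_of_ne hne.symm, hu2]
    have h1 := sideCount_add p d false
    have h2 := key false
    have h3 := key true
    simp only [Bool.not_false, Bool.not_true] at h1 h2 h3
    obtain ⟨k, hk⟩ := hodd d ⟨v, hd⟩
    omega
  · -- the only direction crossed is `d`, so that `v` and its partner form an edge
    push Not at hd2
    have h1 : p v = flip d v := by
      funext i
      by_cases hi : i = d
      · subst hi
        simpa [flip, Bool.eq_not] using hd
      · rw [hd2 i hi, flip, Function.update_of_ne hi]
    have h2 : v ∈ moved p := by simpa [moved] using hv
    refine (hd' v).1 h2 ?_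
    rw [← h1]
    simp only [moved, Finset.mem_filter, Finset.mem_univ, true_and]
    rw [hp]
    exact hv.symm

/-! ### The induction on the dimension -/

/-- A number of pairs up to which, for `n ≥ 4`, every matching of the complete graph on the vertices
of the cube of dimension `n` is shown to be extendable. -/
def pairBound (n : ℕ) : ℕ := 1 + (n + 1) ^ 2 / 8

/-- The growth of `pairBound` does not exceed what is gained by splitting along a balanced
direction, as required in `exists_balanced_direction`. -/
lemma mul_pairBound_succ_le {n : ℕ} :
    (n + 1) * pairBound (n + 1) + 2 ≤ (n + 1) * pairBound n + 2 * pairBound (n + 1) := by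
  have hdiv : ∀ a q r : ℕ, a = 8 * q + r → r < 8 → a / 8 = q := by intros; omega
  have hn : n = 4 * (n / 4) + n % 4 := by omega
  have hr : n % 4 < 4 := Nat.mod_lt _ (by omega)
  generalize n / 4 = j at hn
  generalize n % 4 = r at hn hr
  subst hn
  simp only [pairBound]
  interval_cases r
  · rw [hdiv ((4 * j + 0 + 1 + 1) ^ 2) (2 * j ^ 2 + 2 * j) 4 (by ring) (by omega),
      hdiv ((4 * j + 0 + 1) ^ 2) (2 * j ^ 2 + j) 1 (by ring) (by omega)]
    nlinarith
  · rw [hdiv ((4 * j + 1 + 1 + 1) ^ 2) (2 * j ^ 2 + 3 * j + 1) 1 (by ring) (by omega),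
      hdiv ((4 * j + 1 + 1) ^ 2) (2 * j ^ 2 + 2 * j) 4 (by ring) (by omega)]
    nlinarith
  · rw [hdiv ((4 * j + 2 + 1 + 1) ^ 2) (2 * j ^ 2 + 4 * j + 2) 0 (by ring) (by omega),
      hdiv ((4 * j + 2 + 1) ^ 2) (2 * j ^ 2 + 3 * j + 1) 1 (by ring) (by omega)]
    nlinarith
  · rw [hdiv ((4 * j + 3 + 1 + 1) ^ 2) (2 * (j + 1) ^ 2 + (j + 1)) 1 (by ring) (by omega),
      hdiv ((4 * j + 3 + 1) ^ 2) (2 * (j + 1) ^ 2) 0 (by ring) (by omega)]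
    nlinarith

lemma five_mul_pairBound_lt {n : ℕ} (hn : 6 ≤ n) : 5 * pairBound n < 3 * 2 ^ (n - 2) := by
  induction n, hn using Nat.le_induction with
  | base => decide
  | succ n hn ih =>
    have h1 : 2 ^ (n + 1 - 2) = 2 * 2 ^ (n - 2) := by
      rw [← pow_succ']; congr 1; omega
    have h2 : (n + 1 + 1) ^ 2 ≤ 2 * (n + 1) ^ 2 := by nlinarith
    simp only [pairBound] at ih ⊢
    omega

lemma pairBound_succ_add_two_le {n : ℕ} (hn : 4 ≤ n) :
    pairBound (n + 1) + 2 ≤ 2 * pairBound n := by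
  simp only [pairBound]
  rcases hn.eq_or_lt with rfl | h
  · decide
  · have : (n + 1 + 1) ^ 2 + 24 ≤ 2 * (n + 1) ^ 2 + 8 := by nlinarith
    omega

/-- In dimension `n = k + 4`, matchings of the complete graph with at most `pairBound n` pairs
extend to cycles through at least three quarters of the vertices. In the inductive step, the cube is
split along a balanced direction, so that the parts of the matching in both halves are small. -/
theorem isExtendable_of_card_le (k : ℕ) (p : (Fin (k + 4) → Bool) → (Fin (k + 4) → Bool))
    (hp : Function.Involutive p) (hcard : #(moved p) ≤ 2 * pairBound (k + 4)) :
    IsExtendable (hypercube (k + 4)) p (12 * 2 ^ k) := by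
  induction k with
  | zero => exact isExtendable_four p hp hcard
  | succ k ih =>
    change (Fin (k + 4 + 1) → Bool) → (Fin (k + 4 + 1) → Bool) at p
    obtain ⟨m, hm⟩ := (even_card_moved hp).two_dvd
    have hmle : m ≤ pairBound (k + 4 + 1) := by
      have h1 : pairBound (k + 1 + 4) = pairBound (k + 4 + 1) := by congr 1
      omega
    have hlen : 2 * (12 * 2 ^ k) = 12 * 2 ^ (k + 1) := by rw [pow_succ]; ring
    rw [← hlen]
    -- In dimension five the bound `5 * m < 24` fails for `m = 5`; there it is used below that the
    -- sides contain even numbers of covered vertices if no pair crosses.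
    have hpow : (k = 0 ∧ m ≤ 5) ∨ 5 * m < 24 * 2 ^ k := by
      rcases Nat.eq_zero_or_pos k with rfl | hk
      · exact Or.inl ⟨rfl, hmle⟩
      · right
        have h1 := five_mul_pairBound_lt (n := k + 4 + 1) (by omega)
        have h2 : 2 ^ (k + 4 + 1 - 2) = 8 * 2 ^ k := by
          rw [show k + 4 + 1 - 2 = k + 3 by omega, pow_add]; ring
        omega
    have hpow' : #(moved p) < 2 ^ (k + 4) := by
      have h2 : 2 ^ (k + 4) = 16 * 2 ^ k := by rw [pow_add]; ring
      rcases hpow with ⟨rfl, h⟩ | h <;> omega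
    obtain ⟨d, hd⟩ := exists_balanced_direction (m' := pairBound (k + 4)) (Nat.succ_pos _) hm (by
      have h1 := mul_pairBound_succ_le (n := k + 4)
      obtain ⟨t, ht⟩ := Nat.exists_eq_add_of_le hmle
      rw [ht] at h1
      nlinarith [Nat.zero_le (k * t)])
    by_cases hcross : ∃ v, p v d ≠ v d
    · rcases Nat.even_or_odd (sideCount p d false) with he | ho
      · exact isExtendable_succ_of_even hp (fun q hq hc => ih q hq hc) d hd hcross he
      · refine isExtendable_succ_of_odd hp (fun q hq hc => ih q hq hc) d (fun b => ?_) ho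
          (exists_free_edge d hpow')
        have h1 := hd b
        have h2 := sideCount_add p d false
        obtain ⟨s, hs⟩ := ho
        cases b
        · omega
        · simp only [Bool.not_false] at h2
          omega
    · push Not at hcross
      obtain ⟨b, hb⟩ : ∃ b, sideCount p d (!b) ≤ sideCount p d b := by
        rcases le_total (sideCount p d true) (sideCount p d false) with h | h
        · exact ⟨false, h⟩
        · exact ⟨true, h⟩
      have h1 := sideCount_add p d b
      obtain ⟨s, hs⟩ := even_sideCount_of_no_crossing hp hcross b
      obtain ⟨t, ht⟩ := even_sideCount_of_no_crossing hp hcross (!b)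
      have h2 := pairBound_succ_add_two_le (n := k + 4) (by omega)
      have h3 := hd b
      refine isExtendable_succ_of_no_crossing hp (fun q hq hc => ih q hq hc) d b h3 ?_ hcross ?_
      · omega
      · rcases hpow with ⟨rfl, h⟩ | h <;> omega

/-! ### Matchings of the cube -/

lemma isSingleCycle_hypercube_two : IsSingleCycle (hypercube 2) := by
  constructor
  · have h1 : ∀ v : Fin 2 → Bool, flip 0 v ≠ flip 1 v := by decide
    have h2 : ∀ v x : Fin 2 → Bool, hammingDist v x = 1 ↔ x = flip 0 v ∨ x = flip 1 v := by decide
    exact isCycles_of_forall_adj fun v _ _ => ⟨_, _, h1 v, h2 v⟩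
  · have h : ∀ u v : Fin 2 → Bool, u = v ∨ hammingDist u v = 1 ∨
        ∃ w, hammingDist u w = 1 ∧ hammingDist w v = 1 := by decide
    intro u _ v _
    rcases h u v with rfl | h | ⟨w, h1, h2⟩
    · exact Reachable.refl _
    · exact Adj.reachable h
    · have h1' : (hypercube 2).Adj u w := h1
      have h2' : (hypercube 2).Adj w v := h2
      exact h1'.reachable.trans h2'.reachable

lemma support_hypercube_two : (hypercube 2).support = Set.univ := by
  have h : ∀ v : Fin 2 → Bool, ∃ w, hammingDist v w = 1 := by decide
  exact Set.eq_univ_of_forall h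

/-- The involution that exchanges the ends of the edges of a matching, and the number of its
moved points. -/
lemma exists_involutive_of_isMatching {V : Type*} [Fintype V] [DecidableEq V] {G : SimpleGraph V}
    {M : G.Subgraph} (hM : M.IsMatching) :
    ∃ p : V → V, Function.Involutive p ∧ (∀ v, p v ≠ v → M.Adj v (p v)) ∧
      (∀ v w, M.Adj v w → p v = w) ∧ #(moved p) ≤ 2 * M.edgeSet.ncard := by
  classical
  choose! p hp hu using fun v (hv : v ∈ M.verts) => hM hv
  set r : V → V := fun v => if v ∈ M.verts then p v else v with hr
  have hadj : ∀ v w, M.Adj v w → r v = w := by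
    intro v w h
    simp only [hr, if_pos (M.edge_vert h)]
    exact (hu v (M.edge_vert h) w h).symm
  have hr' : ∀ v, v ∈ M.verts → M.Adj v (r v) := by
    intro v hv
    simp only [hr, if_pos hv]
    exact hp v hv
  have hmoved : ∀ v, r v ≠ v → M.Adj v (r v) := by
    intro v hv
    by_cases h : v ∈ M.verts
    · exact hr' v h
    · exact absurd (by simp [hr, h]) hv
  refine ⟨r, fun v => ?_, hmoved, hadj, ?_⟩
  · by_cases h : r v = v
    · rw [h, h]
    · exact hadj _ _ (hmoved v h).symm
  · have h1 : moved r ⊆ M.edgeSet.toFinset.biUnion fun e => e.toFinset := by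
      intro v hv
      have hv' := hmoved v (Finset.mem_filter.1 hv).2
      rw [Finset.mem_biUnion]
      exact ⟨s(v, r v), by simpa using hv', by simp⟩
    have h2 := (Finset.card_le_card h1).trans
      (Finset.card_biUnion_le_card_mul _ _ 2 fun e _ => by
        rw [Sym2.card_toFinset]; split_ifs <;> simp)
    rw [Set.ncard_eq_toFinset_card']
    omega

end HypercubeMatching

open HypercubeMatching in
theorem mainTheorem1 (n : ℕ) (hn : 2 ≤ n) (M : (hypercube n).Subgraph) (hM : M.IsMatching)
    (hcard : (M.edgeSet.ncard : ℝ) < (n : ℝ) ^ 2 / 12 + (n : ℝ) / 4 + 1 / 2) :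
    ∃ (u : Fin n → Bool) (C : (hypercube n).Walk u u),
      C.IsCycle ∧ (∀ e ∈ M.edgeSet, e ∈ C.edges) ∧
        (3 / 4 : ℝ) * (2 : ℝ) ^ n ≤ (C.length : ℝ) := by
  obtain ⟨p, hp, hpM, hMp, hpcard⟩ := exists_involutive_of_isMatching hM
  have hcard' : 12 * M.edgeSet.ncard < n ^ 2 + 3 * n + 6 := by
    have : (12 * M.edgeSet.ncard : ℝ) < n ^ 2 + 3 * n + 6 := by linarith
    exact_mod_cast this
  have hext : IsExtendable (hypercube n) p (3 * 2 ^ (n - 2)) := by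
    obtain rfl | rfl | h4 : n = 2 ∨ n = 3 ∨ 4 ≤ n := by omega
    · refine ⟨hypercube 2, isSingleCycle_hypercube_two, fun v hv => (hpM v hv).adj_sub,
        fun u v h => Or.inr h, ?_⟩
      rw [support_hypercube_two, Set.ncard_univ]
      simp
    · exact isExtendable_three p hp
    · obtain ⟨k, rfl⟩ := Nat.exists_eq_add_of_le' h4
      refine (isExtendable_of_card_le k p hp (hpcard.trans ?_)).mono (le_of_eq ?_)
      · have h1 : (k + 4 + 1) ^ 2 = (k + 4) ^ 2 + 2 * (k + 4) + 1 := by ring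
        simp only [pairBound]
        nlinarith [Nat.div_add_mod ((k + 4 + 1) ^ 2) 8,
          Nat.mod_lt ((k + 4 + 1) ^ 2) (by omega : 0 < 8)]
      · rw [show k + 4 - 2 = k + 2 by omega, pow_add]; ring
  obtain ⟨C, hC, hpC, hCG, hlen⟩ := hext
  have hpos : 0 < 2 ^ (n - 2) := by positivity
  have hle : C ≤ hypercube n := by
    intro u v huv
    rcases hCG u v huv with h | h
    · exact h ▸ (hpM u (by rw [h]; exact huv.ne')).adj_sub
    · exact h
  obtain ⟨u, w, hw, hedges, hwlen⟩ := hC.exists_walk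
    ((Set.ncard_pos (Set.toFinite _)).1 (by omega))
  refine ⟨u, w.mapLe hle, hw.mapLe hle, ?_, ?_⟩
  · intro e he
    rw [SimpleGraph.Walk.edges_mapLe_eq_edges]
    refine hedges e ?_
    induction e with | _ a b
    have hab : M.Adj a b := he
    have := hpC a (by rw [hMp a b hab]; exact (M.adj_sub hab).ne')
    rwa [hMp a b hab] at this
  · have h1 : (3 / 4 : ℝ) * 2 ^ n = ((3 * 2 ^ (n - 2) : ℕ) : ℝ) := by
      obtain ⟨k, rfl⟩ := Nat.exists_eq_add_of_le' hn
      push_cast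
      rw [pow_add]
      ring
    rw [h1, SimpleGraph.Walk.length_map, hwlen]
    exact_mod_cast hlen
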